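/- Setting. For $\xi\ge 0$ let $G_\xi(v)=\exp(-(1+\xi v)^{-1/\xi})$ if $\xi>0$ and $1+\xi v>0$, $G_\xi(v)=0$ if $\xi>0$ and $1+\xi v\le 0$, and $G_0(v)=\exp(-e^{-v})$. A distribution function $F$ is in the domain of attraction of $G_\xi$ if there are norming constants $a_n>0$, $b_n\in\mathbb R$ with $F^n(a_nv+b_n)\to G_\xi(v)$ for every $v$. Let $D_1,D_2,\dots$ be random elements, let $g(\theta;d)\in\mathbb R^q$, $\theta\in\mathbb R^p$, be a measurable score (or moment) function, let $r>0$, and put $A_i^r(\theta)=\|g(\theta;D_i)\|^r$. Let $\theta_0\in\mathbb R^p$, let $\hat\theta=\hat\theta_n$ be estimators, and let $F$ and $Q$ be the distribution function and the quantile function of $A_i^r(\theta_0)$. Condition 1 with tail index $\xi\ge 0$ says: (i) the $D_i$ are i.i.d., with a law that does not depend on $n$; (ii) $F$ is in the domain of attraction of $G_\xi$, and $Q(1)=\infty$; (iii) $\hat\theta-\theta_0=o_p(1)$, and there are radii $\eta_n\to 0$ with $P(\|\hat\theta-\theta_0\|<\eta_n)\to 1$ and $$\sup_{i\le n}\ \sup_{\|\theta-\theta_0\|<\eta_n}\Big\|\frac{\partial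 A_i^r(\theta)}{\partial\theta}\Big\|=O_p(\rho_n),$$ where $\rho_n=n^{\xi}$ if $\xi>0$, where $\rho_n=1/\big(n f(Q(1-1/n))\big)$ if $\xi=0$ and $A_i^r(\theta_0)$ has the density $f$, and where in both cases $\rho_n=O(a_n)$ for norming constants $a_n$ of $F$ as in (ii). (At a point where $A_i^r$ is not differentiable, the norm of the gradient is read as $\limsup_{\theta'\to\theta}|A_i^r(\theta')-A_i^r(\theta)|/\|\theta'-\theta\|$.) Test. Let $k\ge 3$ and $0<\varepsilon<1$. Let $A^r_{(1)}(\theta)\ge\dots\ge A^r_{(n)}(\theta)$ be the order statistics of $A_1^r(\theta),\dots,A_n^r(\theta)$ and $$\mathbf A_*^r(\hat\theta)=\Big(\frac{A^r_{(j)}(\hat\theta)-A^r_{(k)}(\hat\theta)}{A^r_{(1)}(\hat\theta)-A^r_{(k)}(\hat\theta)}\Big)_{j=1}^k .$$ For $v=(1,v_2,\dots,v_{k-1},0)$ with $1\ge v_2\ge\dots\ge v_{k-1}\ge 0$ let $$f_{\mathbf V_*}(v;\xi)=\Gamma(k)\int_0^\infty s^{k-2}\exp\Big((-1-1/\xi)\sum_{i=1}^k\log(1+\xi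 v_is)\Big)\,ds,$$ where for $\xi=0$ the exponential is read as its limit $\exp(-s\sum_i v_i)$. Let $\mathbf V_*$ be a random vector with this density (with respect to Lebesgue measure in $v_2,\dots,v_{k-1}$), with expectation $\mathbb E_\xi$. For finite Borel measures $W$ and $\Lambda$ let $$\varphi_\Lambda(v)=\mathbf 1\left[\frac{\int_{(1-\varepsilon,2]}f_{\mathbf V_*}(v;\xi)\,dW(\xi)}{\int_{[0,1-\varepsilon]}f_{\mathbf V_*}(v;\xi)\,d\Lambda(\xi)}>1\right].$$ Theorem. Fix $k\ge 3$, $0<\varepsilon<1$, $\alpha>0$ and $W$. (a) For every finite measure $\Lambda_0$ with $\Lambda_0([0,1-\varepsilon])>0$ there is $c_0$ such that for all $c\ge c_0$ the weight $\Lambda=c\Lambda_0$ satisfies $$\sup_{\xi\in[0,1-\varepsilon]}\mathbb E_\xi[\varphi_\Lambda(\mathbf V_*)]\le\alpha .\qquad(*)$$ (b) For every finite measure $\Lambda$, and for every model that satisfies Condition 1 with some $\xi\in[0,1-\varepsilon]$, $$\lim_{n\to\infty}\mathbb E\big[\varphi_\Lambda(\mathbf A_*^r(\hat\theta))\big]=\mathbb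 E_\xi[\varphi_\Lambda(\mathbf V_*)].$$ In particular, if $\Lambda$ satisfies $(*)$, then one and the same test has asymptotic rejection probability at most $\alpha$ in every model that satisfies Condition 1 with some $\xi\in[0,1-\varepsilon]$. -/

import Mathlib

open MeasureTheory ProbabilityTheory Filter Topology Set
open scoped ENNReal NNReal

noncomputable section

namespace FiniteMomentTest

/-! ### Extreme value theory -/

/-- The generalized extreme value distribution function `G_ξ`. -/
def gev (ξ v : ℝ) : ℝ :=
  if ξ = 0 then Real.exp (-Real.exp (-v))
  else if 0 < 1 + ξ * v then Real.exp (-(1 + ξ * v) ^ (-1 / ξ))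
  else if 0 < ξ then 0 else 1

/-- `a n > 0` and `b n` are norming constants for the law `ν` with limit `G_ξ`:
`F(a n * v + b n) ^ n → G_ξ(v)` for every `v`, where `F` is the distribution function of `ν`. -/
def IsNorming (ν : Measure ℝ) (ξ : ℝ) (a b : ℕ → ℝ) : Prop :=
  (∀ n, 0 < a n) ∧
    ∀ v : ℝ, Tendsto (fun n : ℕ => (cdf ν (a n * v + b n)) ^ n) atTop (𝓝 (gev ξ v))

/-- The law `ν` is in the domain of attraction of `G_ξ`. -/
def InDomainOfAttraction (ν : Measure ℝ) (ξ : ℝ) : Prop :=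
  ∃ a b : ℕ → ℝ, IsNorming ν ξ a b

/-- The quantile function `Q(p) = inf {x | p ≤ F(x)}`, with values in the extended reals. -/
def quantile (ν : Measure ℝ) (p : ℝ) : EReal :=
  sInf ((fun x : ℝ => (x : EReal)) '' {x : ℝ | p ≤ cdf ν x})

/-! ### Self-normalized top order statistics -/

/-- The `j`-th largest value among `x 0, …, x (n - 1)` (`j = 0` is the maximum), for `j < n`. -/
def orderStat {n : ℕ} (x : Fin n → ℝ) (j : ℕ) : ℝ :=
  if h : j < n then x (Tuple.sort (fun i => -x i) ⟨j, h⟩) else 0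

/-- The vector `(x₍ⱼ₎ - x₍ₖ₎) / (x₍₁₎ - x₍ₖ₎)`, `j = 1, …, k`, of self-normalized `k` largest
order statistics (indices are shifted by one). -/
def selfNormalizedTop {n : ℕ} (k : ℕ) (x : Fin n → ℝ) : Fin k → ℝ := fun j =>
  (orderStat x j - orderStat x (k - 1)) / (orderStat x 0 - orderStat x (k - 1))

/-! ### The limiting density and the likelihood-ratio test -/

/-- The integrand `exp ((-1 - 1/ξ) ∑ᵢ log (1 + ξ vᵢ s))`, with its limit `exp (-∑ᵢ vᵢ s)`
at `ξ = 0`. -/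
def densityKernel {k : ℕ} (v : Fin k → ℝ) (ξ s : ℝ) : ℝ :=
  if ξ = 0 then Real.exp (-∑ i, v i * s)
  else Real.exp ((-1 - 1 / ξ) * ∑ i, Real.log (1 + ξ * v i * s))

/-- The density of the limit of the self-normalized `k` largest order statistics. -/
def limitDensity {k : ℕ} (v : Fin k → ℝ) (ξ : ℝ) : ℝ≥0∞ :=
  ENNReal.ofReal (Real.Gamma k) *
    ∫⁻ s in Ioi (0 : ℝ), ENNReal.ofReal (s ^ (k - 2) * densityKernel v ξ s)

/-- The weighted likelihood ratio. -/
def likelihoodRatio {k : ℕ} (ε : ℝ) (W Λ : Measure ℝ) (v : Fin k → ℝ) : ℝ≥0∞ :=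
  (∫⁻ ξ in Ioc (1 - ε) 2, limitDensity v ξ ∂W) /
    (∫⁻ ξ in Icc 0 (1 - ε), limitDensity v ξ ∂Λ)

open Classical in
/-- The test: `1` (reject) if the likelihood ratio exceeds one, `0` otherwise. -/
def test {k : ℕ} (ε : ℝ) (W Λ : Measure ℝ) (v : Fin k → ℝ) : ℝ≥0∞ :=
  if 1 < likelihoodRatio ε W Λ v then 1 else 0

/-- The vector `(1, w₁, …, w_{k-2}, 0)`. -/
def completeVec (k : ℕ) (w : Fin (k - 2) → ℝ) : Fin k → ℝ := fun i =>
  if (i : ℕ) = 0 then 1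
  else if h : (i : ℕ) - 1 < k - 2 then w ⟨(i : ℕ) - 1, h⟩ else 0

/-- The free coordinates `1 ≥ w₁ ≥ … ≥ w_{k-2} ≥ 0` of the limit vector. -/
def orderedCube (k : ℕ) : Set (Fin (k - 2) → ℝ) :=
  {w | Antitone w ∧ ∀ i, w i ∈ Icc (0 : ℝ) 1}

/-- `𝔼_ξ[ψ(V_*)]`: the expectation under the density `limitDensity · ξ`, which is a density with
respect to Lebesgue measure in the `k - 2` coordinates that are not identically `1` or `0`. -/
def limitExpectation (k : ℕ) (ξ : ℝ) (ψ : (Fin k → ℝ) → ℝ≥0∞) : ℝ≥0∞ :=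
  ∫⁻ w in orderedCube k, ψ (completeVec k w) * limitDensity (completeVec k w) ξ

/-! ### The statistical model -/

/-- `A^r(θ; d) = ‖g(θ; d)‖ ^ r`, for a score (or moment) function `g`. -/
def scorePower {𝒟 : Type*} {p q : ℕ}
    (g : EuclideanSpace ℝ (Fin p) → 𝒟 → EuclideanSpace ℝ (Fin q)) (r : ℝ)
    (θ : EuclideanSpace ℝ (Fin p)) (d : 𝒟) : ℝ :=
  ‖g θ d‖ ^ r

open Classical in
/-- The norm of the gradient of `h` at `x`. At a point where `h` is not differentiable (a zero of
the score is one when `r = 1`), it is read as the local slope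
`limsup_{y → x} |h y - h x| / ‖y - x‖`, which agrees with the norm of the gradient where the
latter exists. -/
def gradNorm {p : ℕ} (h : EuclideanSpace ℝ (Fin p) → ℝ) (x : EuclideanSpace ℝ (Fin p)) : ℝ≥0∞ :=
  if DifferentiableAt ℝ h x then ENNReal.ofReal ‖gradient h x‖
  else limsup (fun y => ENNReal.ofReal (|h y - h x| / ‖y - x‖)) (𝓝[≠] x)

/-- `sup_{i ≤ n} sup_{θ ∈ B_η(θ₀)} ‖∂A_i(θ)/∂θ‖`. -/
def supGrad {Ω 𝒟 : Type*} {p : ℕ} (A : EuclideanSpace ℝ (Fin p) → 𝒟 → ℝ) (D : ℕ → Ω → 𝒟)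
    (θ₀ : EuclideanSpace ℝ (Fin p)) (η : ℝ) (n : ℕ) (ω : Ω) : ℝ≥0∞ :=
  ⨆ i : Fin n, ⨆ θ ∈ Metric.ball θ₀ η, gradNorm (fun t => A t (D i ω)) θ

/-- `X n = O_p(ρ n)`. -/
def IsBigOInProbability {Ω : Type*} [MeasurableSpace Ω] (μ : Measure Ω) (X : ℕ → Ω → ℝ≥0∞)
    (ρ : ℕ → ℝ) : Prop :=
  ∀ δ : ℝ, 0 < δ → ∃ C : ℝ, ∀ᶠ n in atTop,
    μ {ω | ENNReal.ofReal (C * ρ n) < X n ω} ≤ ENNReal.ofReal δ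

/-- The gradient condition for the rate `ρ`: the supremum of the gradient is `O_p(ρ n)`, where the
rate is at most of the order of the norming constants of the law `ν` of `A(θ₀)`. -/
def GradientCondition {Ω 𝒟 : Type*} [MeasurableSpace Ω] {p : ℕ} (μ : Measure Ω)
    (A : EuclideanSpace ℝ (Fin p) → 𝒟 → ℝ) (D : ℕ → Ω → 𝒟) (θ₀ : EuclideanSpace ℝ (Fin p))
    (η : ℕ → ℝ) (ν : Measure ℝ) (ξ : ℝ) (ρ : ℕ → ℝ) : Prop :=
  IsBigOInProbability μ (fun n => supGrad A D θ₀ (η n) n) ρ ∧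
    ∃ a b : ℕ → ℝ, IsNorming ν ξ a b ∧ ρ =O[atTop] a

/-- The regularity conditions on the data `D`, the statistic `A`, the true value `θ₀`, the
estimators `θhat n` and the tail index `ξ`. -/
structure RegularityConditions {Ω 𝒟 : Type*} [MeasurableSpace Ω] [MeasurableSpace 𝒟] {p : ℕ}
    (μ : Measure Ω) (D : ℕ → Ω → 𝒟) (A : EuclideanSpace ℝ (Fin p) → 𝒟 → ℝ)
    (θ₀ : EuclideanSpace ℝ (Fin p)) (θhat : ℕ → Ω → EuclideanSpace ℝ (Fin p)) (ξ : ℝ) :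
    Prop where
  /-- the observations are independent -/
  indep : iIndepFun D μ
  /-- the observations are identically distributed -/
  ident : ∀ i, IdentDistrib (D i) (D 0) μ μ
  /-- the tail index is nonnegative -/
  nonneg : 0 ≤ ξ
  /-- the law of `A(θ₀)` is in the domain of attraction of `G_ξ` -/
  attraction : InDomainOfAttraction (μ.map fun ω => A θ₀ (D 0 ω)) ξ
  /-- the law of `A(θ₀)` is not bounded above: `Q(1) = ∞` -/
  unbounded : quantile (μ.map fun ω => A θ₀ (D 0 ω)) 1 = ⊤
  /-- the estimator is consistent -/
  consistent : TendstoInMeasure μ θhat atTop (fun _ => θ₀)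
  /-- on balls around `θ₀` with radii `η n → 0` that contain the estimator with probability
  tending to one, the gradient of `A` is `O_p(n ^ ξ)` if `ξ > 0`, and is
  `O_p(1 / (n f(Q(1 - 1/n))))`, with `f` the density of `A(θ₀)`, if `ξ = 0` -/
  gradientBound : ∃ η : ℕ → ℝ, Tendsto η atTop (𝓝 0) ∧
    Tendsto (fun n => μ {ω | θhat n ω ∈ Metric.ball θ₀ (η n)}) atTop (𝓝 1) ∧
    (0 < ξ → GradientCondition μ A D θ₀ η (μ.map fun ω => A θ₀ (D 0 ω)) ξ
      (fun n => (n : ℝ) ^ ξ)) ∧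
    (ξ = 0 → ∃ f : ℝ → ℝ, Measurable f ∧ (∀ x, 0 ≤ f x) ∧
      (μ.map fun ω => A θ₀ (D 0 ω)) = volume.withDensity (fun x => ENNReal.ofReal (f x)) ∧
      GradientCondition μ A D θ₀ η (μ.map fun ω => A θ₀ (D 0 ω)) ξ
        (fun n => 1 / ((n : ℝ) *
          f (quantile (μ.map fun ω => A θ₀ (D 0 ω)) (1 - 1 / (n : ℝ))).toReal)))

/-- `𝔼[φ(A_*(θhat))]`: the rejection probability of the test at sample size `n`, applied to the
self-normalized `k` largest order statistics of `A_1(θhat n), …, A_n(θhat n)`. -/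
def rejectionProb {Ω 𝒟 : Type*} [MeasurableSpace Ω] {p : ℕ} (k : ℕ) (ε : ℝ) (W Λ : Measure ℝ)
    (μ : Measure Ω) (D : ℕ → Ω → 𝒟) (A : EuclideanSpace ℝ (Fin p) → 𝒟 → ℝ)
    (θhat : ℕ → Ω → EuclideanSpace ℝ (Fin p)) (n : ℕ) : ℝ≥0∞ :=
  ∫⁻ ω, test ε W Λ (selfNormalizedTop k fun i : Fin n => A (θhat n ω) (D i ω)) ∂μ

/-- `sup_{ξ ∈ [0, 1 - ε]} 𝔼_ξ[φ(V_*)] ≤ α`. -/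
def HasLimitLevel (k : ℕ) (ε : ℝ) (W Λ : Measure ℝ) (α : ℝ) : Prop :=
  (⨆ ξ ∈ Icc (0 : ℝ) (1 - ε), limitExpectation k ξ (test ε W Λ)) ≤ ENNReal.ofReal α

end FiniteMomentTest

end

open MeasureTheory ProbabilityTheory Filter Topology Set
open scoped ENNReal NNReal

noncomputable section

namespace FiniteMomentTest

/-! ### Generalized Pareto tails -/

/-! Write `k = m + 2`. After centring by `b n` and scaling by `a n`, the `k` largest values of the
sample behave like `tailInv ξ (s i)`, where `s 0 < … < s (k-1)` are the first `k` points of a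
unit-rate Poisson process, with density `exp (-s (k-1))` on the increasing chamber.
Self-normalization is invariant under affine maps, so `a n` and `b n` cancel, and the limit law is
that of the spacing ratios of the `tailInv ξ (s i)`. Given the last point, the others divided by it
are ordered uniforms. Integrating out that point gives the factor `Γ(k)`, and the substitution `u =
tail ξ x` turns the rest into the stated density (`lintegral_openChamber_eq`).

Convergence in law is needed only as a lower bound on liminfs over open sets. Up to ties, the top
values have an explicit joint law (`descFactorial_mul_lintegral_le`). Written in quantile levels `s
/ n`, its density converges pointwise, and Fatou's lemma gives `le_liminf_topValues`. Replacing `θ₀`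
by the estimator moves every observation by at most (gradient bound) times (distance), which is `o(a
n)` in probability (`tendsto_measure_perturbation`). Order statistics are 1-Lipschitz in the sup
norm, so slightly shrunken open sets absorb this change (`le_liminf_ratioRegion`).

The test is discontinuous where the two mixtures of densities agree, so this boundary must be
negligible. In each coordinate the mixtures extend holomorphically to a half-plane. Hence two of
them agree on the whole positive orthant or only on a null set
(`mixtureDensity_eq_or_volume_eq_zero`). In the first case the test never rejects there. In the
second, rejection and acceptance contain disjoint open sets whose limit probabilities add up to one.
Two lower bounds with total one are both limits (`tendsto_lintegral_test`), which is (b).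

For (a), all densities with index in `[0, 2]` are at most `8 ^ (k-1)` times the one with index `2`
(`tailDensity_le`). The rejection sets of `c • Λ₀` shrink to the empty set as `c` grows, since the
denominator is positive and the numerator finite. Dominated convergence then bounds the level
uniformly in `ξ`. -/

/-- The tail `(1 + ξ x) ^ (-1/ξ)` of the generalized Pareto distribution. -/
def tail (ξ x : ℝ) : ℝ :=
  if ξ = 0 then Real.exp (-x) else Real.exp ((-1 / ξ) * Real.log (1 + ξ * x))

/-- The density `(1 + ξ x) ^ (-1/ξ - 1)` of the generalized Pareto distribution. -/
def tailDensity (ξ x : ℝ) : ℝ :=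
  if ξ = 0 then Real.exp (-x) else Real.exp ((-1 - 1 / ξ) * Real.log (1 + ξ * x))

/-- The inverse `(u ^ (-ξ) - 1) / ξ` of `tail ξ`. -/
def tailInv (ξ u : ℝ) : ℝ :=
  if ξ = 0 then -Real.log u else (Real.exp (-ξ * Real.log u) - 1) / ξ

lemma tail_pos (ξ x : ℝ) : 0 < tail ξ x := by
  unfold tail; split_ifs <;> exact Real.exp_pos _

lemma tailDensity_pos (ξ x : ℝ) : 0 < tailDensity ξ x := by
  unfold tailDensity; split_ifs <;> exact Real.exp_pos _

lemma tailDensity_zero_right (ξ : ℝ) : tailDensity ξ 0 = 1 := by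
  simp [tailDensity]

lemma tail_zero_right (ξ : ℝ) : tail ξ 0 = 1 := by
  simp [tail]

lemma tailInv_one (ξ : ℝ) : tailInv ξ 1 = 0 := by
  simp [tailInv]

lemma one_add_mul_tailInv_pos (ξ u : ℝ) : 0 < 1 + ξ * tailInv ξ u := by
  unfold tailInv
  split_ifs with h
  · simp [h]
  · rw [mul_div_cancel₀ _ h]
    linarith [Real.exp_pos (-ξ * Real.log u)]

lemma tail_tailInv (ξ : ℝ) {u : ℝ} (hu : 0 < u) : tail ξ (tailInv ξ u) = u := by
  unfold tail tailInv
  split_ifs with h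
  · simp [Real.exp_log hu]
  · rw [mul_div_cancel₀ _ h, add_sub_cancel, Real.log_exp,
      show -1 / ξ * (-ξ * Real.log u) = Real.log u by field_simp, Real.exp_log hu]

lemma tailInv_tail {ξ x : ℝ} (hx : 0 < 1 + ξ * x) : tailInv ξ (tail ξ x) = x := by
  unfold tail tailInv
  split_ifs with h
  · simp
  · rw [Real.log_exp, show -ξ * (-1 / ξ * Real.log (1 + ξ * x)) = Real.log (1 + ξ * x) by
      field_simp, Real.exp_log hx]
    field_simp
    ring

lemma hasDerivAt_tail {ξ x : ℝ} (hx : 0 < 1 + ξ * x) :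
    HasDerivAt (tail ξ) (-tailDensity ξ x) x := by
  by_cases h : ξ = 0
  · subst h
    have h1 : tail 0 = fun x => Real.exp (-x) := by funext x; simp [tail]
    rw [h1]
    simpa [tailDensity] using (hasDerivAt_neg x).exp
  · have h1 : tail ξ = fun x => Real.exp ((-1 / ξ) * Real.log (1 + ξ * x)) := by
      funext x; simp [tail, h]
    rw [h1]
    have h2 : HasDerivAt (fun x => 1 + ξ * x) ξ x := by
      simpa using ((hasDerivAt_id x).const_mul ξ).const_add 1
    have h3 := ((h2.log hx.ne').const_mul (-1 / ξ)).exp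
    convert h3 using 1
    simp only [tailDensity, h, if_false]
    rw [show (-1 - 1 / ξ) * Real.log (1 + ξ * x)
      = -1 / ξ * Real.log (1 + ξ * x) - Real.log (1 + ξ * x) by ring, Real.exp_sub,
      Real.exp_log hx]
    field_simp

lemma tailInv_lt_tailInv {ξ s t : ℝ} (hξ : 0 ≤ ξ) (hs : 0 < s) (hst : s < t) :
    tailInv ξ t < tailInv ξ s := by
  have hl := Real.log_lt_log hs hst
  unfold tailInv
  split_ifs with h
  · linarith
  · have hp : 0 < ξ := lt_of_le_of_ne hξ (Ne.symm h)
    have : Real.exp (-ξ * Real.log t) < Real.exp (-ξ * Real.log s) :=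
      Real.exp_lt_exp.2 (by nlinarith)
    gcongr

lemma one_add_mul_pos {ξ x : ℝ} (hξ : 0 ≤ ξ) (hx : 0 ≤ x) : 0 < 1 + ξ * x := by
  have := mul_nonneg hξ hx
  linarith

lemma tail_lt_tail {ξ x y : ℝ} (hξ : 0 ≤ ξ) (hx : 0 < 1 + ξ * x) (hxy : x < y) :
    tail ξ y < tail ξ x := by
  by_contra! hcon
  have hy : 0 < 1 + ξ * y := by nlinarith
  rcases hcon.lt_or_eq with hlt | heq
  · have := tailInv_lt_tailInv hξ (tail_pos ξ x) hlt
    rw [tailInv_tail hx, tailInv_tail hy] at this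
    linarith
  · have := congrArg (tailInv ξ) heq
    rw [tailInv_tail hx, tailInv_tail hy] at this
    linarith

lemma tailInv_pos {ξ u : ℝ} (hξ : 0 ≤ ξ) (hu : 0 < u) (hu1 : u < 1) : 0 < tailInv ξ u := by
  simpa [tailInv_one] using tailInv_lt_tailInv hξ hu hu1

lemma tail_lt_one {ξ x : ℝ} (hξ : 0 ≤ ξ) (hx : 0 < x) : tail ξ x < 1 := by
  simpa [tail_zero_right] using tail_lt_tail hξ (x := 0) (by simp) hx

/-- Scaling the argument of `tailInv` is an affine change of its value. -/
lemma tailInv_mul_sub (ξ : ℝ) {y u : ℝ} (hy : 0 < y) (hu : 0 < u) :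
    tailInv ξ (y * u) - tailInv ξ y = Real.exp (-ξ * Real.log y) * tailInv ξ u := by
  unfold tailInv
  rw [Real.log_mul hy.ne' hu.ne']
  split_ifs with h
  · simp [h]
  · rw [mul_add, Real.exp_add]
    ring

lemma gev_eq_exp_neg_tail {ξ v : ℝ} (hv : 0 < 1 + ξ * v) :
    gev ξ v = Real.exp (-tail ξ v) := by
  unfold gev tail
  split_ifs with h
  · rfl
  · rw [Real.rpow_def_of_pos hv, mul_comm]

lemma gev_tailInv (ξ : ℝ) {s : ℝ} (hs : 0 < s) : gev ξ (tailInv ξ s) = Real.exp (-s) := by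
  rw [gev_eq_exp_neg_tail (one_add_mul_tailInv_pos ξ s), tail_tailInv ξ hs]

/-- Monotonicity of `tail` places `G_ξ` strictly on one side of `exp (-s)` on each side of `tailInv
ξ s`. Strictness is what lets a comparison of limits pass to all large `n` in
`tendsto_upperQuantile`. -/
lemma exp_neg_lt_gev {ξ s w : ℝ} (hξ : 0 ≤ ξ) (hs : 0 < s) (hw : tailInv ξ s < w) :
    Real.exp (-s) < gev ξ w := by
  have h1 := one_add_mul_tailInv_pos ξ s
  have h2 : 0 < 1 + ξ * w := by nlinarith
  rw [gev_eq_exp_neg_tail h2]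
  have := tail_lt_tail hξ h1 hw
  rw [tail_tailInv ξ hs] at this
  exact Real.exp_lt_exp.2 (by linarith)

lemma gev_lt_exp_neg {ξ s w : ℝ} (hξ : 0 ≤ ξ) (hs : 0 < s) (hw : w < tailInv ξ s) :
    gev ξ w < Real.exp (-s) := by
  by_cases h2 : 0 < 1 + ξ * w
  · rw [gev_eq_exp_neg_tail h2]
    have := tail_lt_tail hξ h2 hw
    rw [tail_tailInv ξ hs] at this
    exact Real.exp_lt_exp.2 (by linarith)
  · have h3 : ξ ≠ 0 := by rintro rfl; simp at h2
    have h4 : 0 < ξ := lt_of_le_of_ne hξ (Ne.symm h3)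
    simp [gev, h2, h3, h4, Real.exp_pos]

/-- Although `gev` is defined piecewise, values of `tailInv` satisfy `1 + ξ v > 0` strictly, so a
single smooth formula holds nearby. -/
lemma continuousAt_gev_tailInv (ξ : ℝ) {s : ℝ} :
    ContinuousAt (gev ξ) (tailInv ξ s) := by
  have h1 := one_add_mul_tailInv_pos ξ s
  have h2 : ∀ᶠ w in 𝓝 (tailInv ξ s), 0 < 1 + ξ * w :=
    Tendsto.eventually_const_lt h1
      (Continuous.tendsto (f := fun w : ℝ => 1 + ξ * w) (by fun_prop) _)
  have h3 : (fun w => Real.exp (-tail ξ w)) =ᶠ[𝓝 (tailInv ξ s)] gev ξ := by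
    filter_upwards [h2] with w hw using (gev_eq_exp_neg_tail hw).symm
  exact ((hasDerivAt_tail h1).continuousAt.neg.rexp).congr h3

@[fun_prop]
lemma measurable_tailDensity : Measurable fun z : ℝ × ℝ => tailDensity z.1 z.2 := by
  unfold tailDensity
  refine Measurable.ite (measurable_fst (measurableSet_singleton 0)) ?_ ?_ <;> fun_prop

@[fun_prop]
lemma measurable_tailInv (ξ : ℝ) : Measurable (tailInv ξ) := by
  unfold tailInv
  split_ifs <;> fun_prop

/-- For tail indices in `[0, 2]`, the generalized Pareto densities are dominated by a multiple of
the one with index `2`. -/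
lemma tailDensity_le {ξ x : ℝ} (hξ : 0 ≤ ξ) (hξ2 : ξ ≤ 2) (hx : 0 ≤ x) :
    tailDensity ξ x ≤ 8 * tailDensity 2 x := by
  have hpos : (0 : ℝ) < 1 + x / 2 := by positivity
  set L := Real.log (1 + x / 2) with hL
  have hLx : L ≤ x / 2 := by
    have := Real.log_le_sub_one_of_pos hpos
    linarith
  have hL0 : 0 ≤ L := Real.log_nonneg (by linarith)
  -- The intermediate function `(1 + x/2) ^ (-3/2)` works for all indices: `3/2` is the exponent at
  -- `ξ = 2`, and `1/2` is the threshold below which concavity takes over.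
  have key : tailDensity ξ x ≤ Real.exp (-(3 / 2) * L) := by
    unfold tailDensity
    split_ifs with h
    · exact Real.exp_le_exp.2 (by linarith)
    · have hp : 0 < ξ := lt_of_le_of_ne hξ (Ne.symm h)
      refine Real.exp_le_exp.2 ?_
      have hlog0 : 0 ≤ Real.log (1 + ξ * x) := Real.log_nonneg (by nlinarith)
      rcases le_total (1 / 2) ξ with h1 | h1
      · have h2 : L ≤ Real.log (1 + ξ * x) := Real.log_le_log hpos (by nlinarith)
        have h3 : (1 : ℝ) / 2 ≤ 1 / ξ := one_div_le_one_div_of_le hp hξ2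
        nlinarith
      · -- concavity of the logarithm
        have h2 : 2 * ξ * L ≤ Real.log (1 + ξ * x) := by
          have hc := strictConcaveOn_log_Ioi.concaveOn.2 (show 1 + x / 2 ∈ Ioi 0 from hpos)
            (show (1 : ℝ) ∈ Ioi 0 from Set.mem_Ioi.2 one_pos) (show 0 ≤ 2 * ξ by linarith)
            (show 0 ≤ 1 - 2 * ξ by linarith) (by ring)
          simp only [smul_eq_mul, Real.log_one, mul_zero, add_zero, mul_one] at hc
          rwa [show 2 * ξ * (1 + x / 2) + (1 - 2 * ξ) = 1 + ξ * x by ring] at hc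
        have h3 : 2 * L ≤ 1 / ξ * Real.log (1 + ξ * x) := by
          rw [one_div, inv_mul_eq_div, le_div_iff₀ hp]
          linarith
        nlinarith
  have h8 : Real.log 4 = 2 * Real.log 2 := by
    rw [show (4 : ℝ) = 2 ^ 2 by norm_num, Real.log_pow]; norm_num
  -- From `1 + 2 x ≤ 4 (1 + x/2)`; the constant `8` is `4 ^ (3/2)`.
  have h9 : Real.log (1 + 2 * x) ≤ Real.log 4 + L := by
    rw [hL, ← Real.log_mul (by norm_num) hpos.ne']
    exact Real.log_le_log (by linarith) (by linarith)
  have h10 : tailDensity 2 x = Real.exp (-(3 / 2) * Real.log (1 + 2 * x)) := by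
    unfold tailDensity
    norm_num
  have h11 : (8 : ℝ) = Real.exp (3 * Real.log 2) := by
    rw [mul_comm, Real.exp_mul, Real.exp_log (by norm_num)]
    norm_num
  refine key.trans ?_
  rw [h10, h11, ← Real.exp_add]
  exact Real.exp_le_exp.2 (by linarith)

lemma tailDensity_anti {ξ x y : ℝ} (hξ : 0 ≤ ξ) (hx : 0 ≤ x) (hxy : x ≤ y) :
    tailDensity ξ y ≤ tailDensity ξ x := by
  unfold tailDensity
  split_ifs with h
  · exact Real.exp_le_exp.2 (by linarith)
  · have hp : 0 < ξ := lt_of_le_of_ne hξ (Ne.symm h)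
    have h1 : Real.log (1 + ξ * x) ≤ Real.log (1 + ξ * y) :=
      Real.log_le_log (by nlinarith) (by nlinarith)
    have h2 : 0 < 1 / ξ := by positivity
    exact Real.exp_le_exp.2 (by nlinarith)

lemma densityKernel_eq_prod {k : ℕ} (v : Fin k → ℝ) (ξ s : ℝ) :
    densityKernel v ξ s = ∏ i, tailDensity ξ (v i * s) := by
  unfold densityKernel tailDensity
  split_ifs with h
  · rw [← Finset.sum_neg_distrib, Real.exp_sum]
  · rw [Finset.mul_sum, Real.exp_sum]
    simp [mul_assoc]

/-! ### Integrals over finite products of the real line -/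

lemma lintegral_insertNth {n : ℕ} (i : Fin (n + 1)) {f : (Fin (n + 1) → ℝ) → ℝ≥0∞}
    (hf : Measurable f) :
    ∫⁻ x, f x = ∫⁻ y : ℝ, ∫⁻ t : Fin n → ℝ, f (i.insertNth y t) := by
  have h := (volume_preserving_piFinSuccAbove (fun _ : Fin (n + 1) => ℝ) i).symm
  rw [← h.lintegral_comp hf]
  have hm : Measurable fun z => f ((MeasurableEquiv.piFinSuccAbove
      (fun _ : Fin (n + 1) => ℝ) i).symm z) := hf.comp h.measurable
  rw [Measure.volume_eq_prod, lintegral_prod _ hm.aemeasurable]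
  rfl

lemma measurable_insertNth {n : ℕ} (i : Fin (n + 1)) :
    Measurable fun z : ℝ × (Fin n → ℝ) => (i.insertNth z.1 z.2 : Fin (n + 1) → ℝ) :=
  (MeasurableEquiv.piFinSuccAbove (fun _ : Fin (n + 1) => ℝ) i).symm.measurable

lemma lintegral_eq_mul_lintegral_smul {d : ℕ} {f : (Fin d → ℝ) → ℝ≥0∞} (hf : Measurable f) {y : ℝ}
    (hy : 0 < y) : ∫⁻ t, f t = ENNReal.ofReal (y ^ d) * ∫⁻ u, f (y • u) := by
  have hyd : 0 < y ^ d := pow_pos hy d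
  rw [← lintegral_map hf (measurable_const_smul y), Measure.map_addHaar_smul _ hy.ne',
    lintegral_smul_measure, Module.finrank_fin_fun, abs_of_pos (inv_pos.2 hyd), smul_eq_mul,
    ← mul_assoc, ← ENNReal.ofReal_mul hyd.le, mul_inv_cancel₀ hyd.ne', ENNReal.ofReal_one, one_mul]

/-- Applying one function in every coordinate has a diagonal derivative, so the Jacobian is the
product of the one-dimensional derivatives. -/
lemma lintegral_image_coordinatewise {d : ℕ} {S : Set (Fin d → ℝ)} (hS : MeasurableSet S)
    {φ φ' : ℝ → ℝ} {I : Set ℝ} (hSI : ∀ x ∈ S, ∀ i, x i ∈ I) (hinj : InjOn φ I)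
    (hφ : ∀ x ∈ I, HasDerivAt φ (φ' x) x) (f : (Fin d → ℝ) → ℝ≥0∞) :
    ∫⁻ u in (fun x i => φ (x i)) '' S, f u =
      ∫⁻ x in S, (∏ i, ENNReal.ofReal |φ' (x i)|) * f fun i => φ (x i) := by
  have hd : ∀ x ∈ S, HasFDerivWithinAt (fun (x : Fin d → ℝ) i => φ (x i))
      (ContinuousLinearMap.pi fun i =>
        (ContinuousLinearMap.toSpanSingleton ℝ (φ' (x i))).comp
          (ContinuousLinearMap.proj (R := ℝ) (φ := fun _ : Fin d => ℝ) i)) S x := by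
    intro x hx
    refine HasFDerivAt.hasFDerivWithinAt (hasFDerivAt_pi.2 fun i => ?_)
    exact HasFDerivAt.comp x (hφ _ (hSI x hx i)).hasFDerivAt
      (ContinuousLinearMap.proj (R := ℝ) (φ := fun _ : Fin d => ℝ) i).hasFDerivAt
  have hi : InjOn (fun (x : Fin d → ℝ) i => φ (x i)) S := by
    intro x hx y hy hxy
    funext i
    exact hinj (hSI x hx i) (hSI y hy i) (congrFun hxy i)
  rw [lintegral_image_eq_lintegral_abs_det_fderiv_mul volume hS hd hi]
  refine setLIntegral_congr_fun hS fun x hx => ?_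
  rw [ContinuousLinearMap.det_pi, Finset.abs_prod, ENNReal.ofReal_prod_of_nonneg
    (fun i _ => abs_nonneg _)]
  simp

/-! ### The ordered simplex -/

/-- The increasing vectors with coordinates in `(0, y)`. -/
def openSimplex (d : ℕ) (y : ℝ) : Set (Fin d → ℝ) :=
  {t | StrictMono t ∧ ∀ i, 0 < t i ∧ t i < y}

/-- The increasing vectors with positive coordinates. -/
def openChamber (d : ℕ) : Set (Fin d → ℝ) :=
  {t | StrictMono t ∧ ∀ i, 0 < t i}

/-- The decreasing vectors with coordinates in `(0, y)`. -/
def reverseSimplex (d : ℕ) (y : ℝ) : Set (Fin d → ℝ) :=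
  {t | StrictAnti t ∧ ∀ i, 0 < t i ∧ t i < y}

/-- The decreasing vectors with positive coordinates. -/
def reverseChamber (d : ℕ) : Set (Fin d → ℝ) :=
  {t | StrictAnti t ∧ ∀ i, 0 < t i}

lemma measurableSet_strictMono (d : ℕ) : MeasurableSet {t : Fin d → ℝ | StrictMono t} := by
  have : {t : Fin d → ℝ | StrictMono t} = ⋂ i, ⋂ j, ⋂ (_ : i < j), {t | t i < t j} := by
    ext t; simp [StrictMono]
  rw [this]
  exact MeasurableSet.iInter fun i => MeasurableSet.iInter fun j => MeasurableSet.iInter fun _ =>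
    measurableSet_lt (measurable_pi_apply i) (measurable_pi_apply j)

lemma measurableSet_strictAnti (d : ℕ) : MeasurableSet {t : Fin d → ℝ | StrictAnti t} := by
  have : {t : Fin d → ℝ | StrictAnti t} = ⋂ i, ⋂ j, ⋂ (_ : i < j), {t | t j < t i} := by
    ext t; simp [StrictAnti]
  rw [this]
  exact MeasurableSet.iInter fun i => MeasurableSet.iInter fun j => MeasurableSet.iInter fun _ =>
    measurableSet_lt (measurable_pi_apply j) (measurable_pi_apply i)

lemma measurableSet_forall_pos (d : ℕ) : MeasurableSet {t : Fin d → ℝ | ∀ i, 0 < t i} := by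
  rw [ofPred_forall]
  exact MeasurableSet.iInter fun i => measurableSet_lt measurable_const (measurable_pi_apply i)

lemma measurableSet_forall_mem_Ioo (d : ℕ) (y : ℝ) :
    MeasurableSet {t : Fin d → ℝ | ∀ i, 0 < t i ∧ t i < y} := by
  rw [ofPred_forall]
  exact MeasurableSet.iInter fun i => (measurableSet_lt measurable_const (measurable_pi_apply i)).inter
    (measurableSet_lt (measurable_pi_apply i) measurable_const)

lemma measurableSet_openSimplex (d : ℕ) (y : ℝ) : MeasurableSet (openSimplex d y) :=
  (measurableSet_strictMono d).inter (measurableSet_forall_mem_Ioo d y)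

lemma measurableSet_reverseSimplex (d : ℕ) (y : ℝ) : MeasurableSet (reverseSimplex d y) :=
  (measurableSet_strictAnti d).inter (measurableSet_forall_mem_Ioo d y)

lemma measurableSet_openChamber (d : ℕ) : MeasurableSet (openChamber d) :=
  (measurableSet_strictMono d).inter (measurableSet_forall_pos d)

lemma measurableSet_reverseChamber (d : ℕ) : MeasurableSet (reverseChamber d) :=
  (measurableSet_strictAnti d).inter (measurableSet_forall_pos d)

lemma strictMono_snoc_iff {d : ℕ} (t : Fin d → ℝ) (y : ℝ) :
    StrictMono (Fin.snoc t y : Fin (d + 1) → ℝ) ↔ StrictMono t ∧ ∀ i, t i < y := by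
  constructor
  · intro h
    refine ⟨fun i j hij => ?_, fun i => ?_⟩
    · simpa using h (Fin.castSucc_lt_castSucc_iff.2 hij)
    · simpa using h (Fin.castSucc_lt_last i)
  · rintro ⟨h1, h2⟩ i j hij
    induction j using Fin.lastCases with
    | last =>
      induction i using Fin.lastCases with
      | last => exact absurd hij (lt_irrefl _)
      | cast i => simpa using h2 i
    | cast j =>
      induction i using Fin.lastCases with
      | last => exact absurd hij (not_lt.2 (Fin.le_last _))
      | cast i => simpa using h1 (Fin.castSucc_lt_castSucc_iff.1 hij)

lemma strictAnti_cons_iff {d : ℕ} (y : ℝ) (t : Fin d → ℝ) :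
    StrictAnti (Fin.cons y t : Fin (d + 1) → ℝ) ↔ StrictAnti t ∧ ∀ i, t i < y := by
  constructor
  · intro h
    refine ⟨fun i j hij => ?_, fun i => ?_⟩
    · simpa using h (Fin.succ_lt_succ_iff.2 hij)
    · simpa using h (Fin.succ_pos i)
  · rintro ⟨h1, h2⟩ i j hij
    induction i using Fin.cases with
    | zero =>
      induction j using Fin.cases with
      | zero => exact absurd hij (lt_irrefl _)
      | succ j => simpa using h2 j
    | succ i =>
      induction j using Fin.cases with
      | zero => exact absurd hij (not_lt.2 (Fin.zero_le _))
      | succ j => simpa using h1 (Fin.succ_lt_succ_iff.1 hij)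

lemma snoc_mem_openSimplex {d : ℕ} {t : Fin d → ℝ} {z y : ℝ} :
    (Fin.snoc t z : Fin (d + 1) → ℝ) ∈ openSimplex (d + 1) y ↔
      z ∈ Ioo 0 y ∧ t ∈ openSimplex d z := by
  simp only [openSimplex, mem_ofPred_eq, strictMono_snoc_iff, Fin.forall_fin_succ', Fin.snoc_castSucc,
    Fin.snoc_last, mem_Ioo]
  constructor
  · rintro ⟨⟨h1, h2⟩, h3, h4⟩
    exact ⟨h4, h1, fun i => ⟨(h3 i).1, h2 i⟩⟩
  · rintro ⟨h4, h1, h2⟩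
    exact ⟨⟨h1, fun i => (h2 i).2⟩, fun i => ⟨(h2 i).1, (h2 i).2.trans h4.2⟩, h4⟩

lemma snoc_mem_openChamber {d : ℕ} {t : Fin d → ℝ} {z : ℝ} :
    (Fin.snoc t z : Fin (d + 1) → ℝ) ∈ openChamber (d + 1) ↔
      z ∈ Ioi 0 ∧ t ∈ openSimplex d z := by
  simp only [openSimplex, openChamber, mem_ofPred_eq, strictMono_snoc_iff, Fin.forall_fin_succ',
    Fin.snoc_castSucc, Fin.snoc_last, mem_Ioi]
  constructor
  · rintro ⟨⟨h1, h2⟩, h3, h4⟩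
    exact ⟨h4, h1, fun i => ⟨h3 i, h2 i⟩⟩
  · rintro ⟨h4, h1, h2⟩
    exact ⟨⟨h1, fun i => (h2 i).2⟩, fun i => (h2 i).1, h4⟩

lemma cons_mem_reverseChamber {d : ℕ} {t : Fin d → ℝ} {z : ℝ} :
    (Fin.cons z t : Fin (d + 1) → ℝ) ∈ reverseChamber (d + 1) ↔
      z ∈ Ioi 0 ∧ t ∈ reverseSimplex d z := by
  simp only [reverseSimplex, reverseChamber, mem_ofPred_eq, strictAnti_cons_iff, Fin.forall_fin_succ,
    Fin.cons_zero, Fin.cons_succ, mem_Ioi]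
  constructor
  · rintro ⟨⟨h1, h2⟩, h4, h3⟩
    exact ⟨h4, h1, fun i => ⟨h3 i, h2 i⟩⟩
  · rintro ⟨h4, h1, h2⟩
    exact ⟨⟨h1, fun i => (h2 i).2⟩, h4, fun i => (h2 i).1⟩

lemma smul_mem_openSimplex {d : ℕ} {u : Fin d → ℝ} {y : ℝ} (hy : 0 < y) :
    y • u ∈ openSimplex d y ↔ u ∈ openSimplex d 1 := by
  simp only [openSimplex, mem_ofPred_eq, StrictMono, Pi.smul_apply, smul_eq_mul,
    mul_lt_mul_iff_right₀ hy, mul_pos_iff_of_pos_left hy, mul_lt_iff_lt_one_right hy]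

lemma smul_mem_reverseSimplex {d : ℕ} {u : Fin d → ℝ} {y : ℝ} (hy : 0 < y) :
    y • u ∈ reverseSimplex d y ↔ u ∈ reverseSimplex d 1 := by
  simp only [reverseSimplex, mem_ofPred_eq, StrictAnti, Pi.smul_apply, smul_eq_mul,
    mul_lt_mul_iff_right₀ hy, mul_pos_iff_of_pos_left hy, mul_lt_iff_lt_one_right hy]

/-- Slicing along the largest coordinate `z` leaves a simplex of size `z` in one dimension less. -/
lemma volume_openSimplex (d : ℕ) (y : ℝ) (hy : 0 ≤ y) :
    volume (openSimplex d y) = ENNReal.ofReal (y ^ d / d.factorial) := by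
  induction d generalizing y with
  | zero =>
    have : openSimplex 0 y = univ := by
      ext t
      simp [openSimplex, StrictMono]
    rw [this]
    simp [volume_pi]
  | succ d ih =>
    rw [← lintegral_indicator_one (measurableSet_openSimplex _ _),
      lintegral_insertNth (Fin.last d)
        (measurable_one.indicator (measurableSet_openSimplex _ _))]
    have h1 : ∀ z : ℝ, ∫⁻ t : Fin d → ℝ, (openSimplex (d + 1) y).indicator 1
        ((Fin.last d).insertNth z t : Fin (d + 1) → ℝ) =
        (Ioo 0 y).indicator (fun z => ENNReal.ofReal (z ^ d / d.factorial)) z := by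
      intro z
      simp only [Fin.insertNth_last']
      by_cases hz : z ∈ Ioo 0 y
      · rw [indicator_of_mem hz, ← ih z hz.1.le,
          ← lintegral_indicator_one (measurableSet_openSimplex _ _)]
        refine lintegral_congr fun t => ?_
        have h2 := snoc_mem_openSimplex (t := t) (z := z) (y := y)
        by_cases ht : t ∈ openSimplex d z
        · rw [indicator_of_mem ht, indicator_of_mem (h2.2 ⟨hz, ht⟩)]
          rfl
        · rw [indicator_of_notMem ht, indicator_of_notMem fun h => ht (h2.1 h).2]
      · rw [indicator_of_notMem hz]
        simp only [indicator, snoc_mem_openSimplex, hz, false_and, if_false, lintegral_zero]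
    simp only [h1]
    rw [lintegral_indicator measurableSet_Ioo, restrict_Ioo_eq_restrict_Ioc,
      ← ofReal_integral_eq_lintegral_ofReal, ← intervalIntegral.integral_of_le hy]
    · congr 1
      rw [intervalIntegral.integral_div, integral_pow, Nat.factorial_succ]
      push_cast
      field_simp
      simp
    · exact (Continuous.integrableOn_Icc (by fun_prop)).mono_set Ioc_subset_Icc_self
    · filter_upwards [ae_restrict_mem measurableSet_Ioc] with z hz
      have := hz.1.le
      positivity

/-! ### The limiting law -/

lemma completeVec_zero {m : ℕ} (w : Fin m → ℝ) : completeVec (m + 2) w 0 = 1 := by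
  simp [completeVec]

lemma completeVec_castSucc_succ {m : ℕ} (w : Fin m → ℝ) (i : Fin m) :
    completeVec (m + 2) w i.succ.castSucc = w i := by
  simp [completeVec]

lemma completeVec_last {m : ℕ} (w : Fin m → ℝ) : completeVec (m + 2) w (Fin.last (m + 1)) = 0 := by
  simp [completeVec]

lemma densityKernel_completeVec {m : ℕ} (w : Fin m → ℝ) (ξ s : ℝ) :
    densityKernel (completeVec (m + 2) w) ξ s =
      tailDensity ξ s * ∏ i, tailDensity ξ (w i * s) := by
  rw [densityKernel_eq_prod, Fin.prod_univ_castSucc, Fin.prod_univ_succ, Fin.castSucc_zero,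
    completeVec_zero, completeVec_last, one_mul, zero_mul, tailDensity_zero_right, mul_one]
  simp only [completeVec_castSucc_succ]

lemma limitDensity_completeVec {m : ℕ} (w : Fin m → ℝ) (ξ : ℝ) :
    limitDensity (completeVec (m + 2) w) ξ = ENNReal.ofReal (Real.Gamma (m + 2)) *
      ∫⁻ s in Ioi (0 : ℝ), ENNReal.ofReal
        (s ^ m * (tailDensity ξ s * ∏ i, tailDensity ξ (w i * s))) := by
  simp only [limitDensity, densityKernel_completeVec]
  norm_num

/-- The inner coordinates of the self-normalization of a vector. -/
def spacingRatio (m : ℕ) (x : Fin (m + 2) → ℝ) : Fin m → ℝ := fun i =>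
  (x i.succ.castSucc - x (Fin.last (m + 1))) / (x 0 - x (Fin.last (m + 1)))

lemma measurable_spacingRatio (m : ℕ) : Measurable (spacingRatio m) := by
  unfold spacingRatio
  fun_prop

/-- By `tailInv_mul_sub` every spacing carries the same factor `y ^ (-ξ)`, which cancels. So the
ratios do not depend on the last Poisson point. -/
lemma spacingRatio_tailInv {m : ℕ} (ξ : ℝ) {y : ℝ} (hy : 0 < y) {u : Fin (m + 1) → ℝ}
    (hu : ∀ i, 0 < u i) :
    spacingRatio m (fun i => tailInv ξ ((Fin.snoc (y • u) y : Fin (m + 2) → ℝ) i)) =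
      fun i => tailInv ξ (u i.succ) / tailInv ξ (u 0) := by
  funext i
  have h0 : (Fin.snoc (y • u) y : Fin (m + 2) → ℝ) 0 = y * u 0 :=
    Fin.snoc_castSucc (α := fun _ => ℝ) (x := y) (p := y • u) (i := 0)
  simp only [spacingRatio, Fin.snoc_last, Fin.snoc_castSucc, h0, Pi.smul_apply, smul_eq_mul]
  rw [tailInv_mul_sub ξ hy (hu _), tailInv_mul_sub ξ hy (hu _),
    mul_div_mul_left _ _ (Real.exp_pos _).ne']

lemma lintegral_pow_mul_exp_neg (n : ℕ) :
    ∫⁻ y in Ioi (0 : ℝ), ENNReal.ofReal (y ^ n * Real.exp (-y)) =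
      ENNReal.ofReal (Real.Gamma (n + 1)) := by
  have hpos : (0 : ℝ) < n + 1 := by positivity
  rw [Real.Gamma_eq_integral hpos, ofReal_integral_eq_lintegral_ofReal
    (Real.GammaIntegral_convergent hpos)]
  · refine setLIntegral_congr_fun measurableSet_Ioi fun y hy => ?_
    simp [mul_comm]
  · filter_upwards [ae_restrict_mem measurableSet_Ioi] with y hy
    have : (0 : ℝ) < y := hy
    positivity

/-- Put `s = (y u, y)`: the Jacobian is `y ^ (m + 1)`, the ratios are free of `y`, and the integral
of `y ^ (m + 1) * exp (-y)` is `Γ(m + 2)`. -/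
lemma lintegral_openChamber_peel {m : ℕ} {ξ : ℝ} {ψ : (Fin m → ℝ) → ℝ≥0∞}
    (hψ : Measurable ψ) :
    ∫⁻ s in openChamber (m + 2), ψ (spacingRatio m fun i => tailInv ξ (s i)) *
        ENNReal.ofReal (Real.exp (-s (Fin.last (m + 1)))) =
      ENNReal.ofReal (Real.Gamma (m + 2)) *
        ∫⁻ u in openSimplex (m + 1) 1, ψ fun i => tailInv ξ (u i.succ) / tailInv ξ (u 0) := by
  have hg : Measurable fun s : Fin (m + 2) → ℝ => ψ (spacingRatio m fun i => tailInv ξ (s i)) *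
      ENNReal.ofReal (Real.exp (-s (Fin.last (m + 1)))) := by
    refine (hψ.comp ((measurable_spacingRatio m).comp ?_)).mul (by fun_prop)
    exact measurable_pi_iff.2 fun i => (measurable_tailInv ξ).comp (measurable_pi_apply i)
  have hG := hg.indicator (measurableSet_openChamber (m + 2))
  set J := ∫⁻ u in openSimplex (m + 1) 1, ψ fun i => tailInv ξ (u i.succ) / tailInv ξ (u 0)
    with hJ
  rw [← lintegral_indicator (measurableSet_openChamber _),
    lintegral_insertNth (Fin.last _) hG]
  have h1 : ∀ y : ℝ, ∫⁻ t : Fin (m + 1) → ℝ, (openChamber (m + 2)).indicator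
      (fun s : Fin (m + 2) → ℝ => ψ (spacingRatio m fun i => tailInv ξ (s i)) *
        ENNReal.ofReal (Real.exp (-s (Fin.last (m + 1)))))
      ((Fin.last (m + 1)).insertNth y t : Fin (m + 2) → ℝ) =
      (Ioi 0).indicator (fun y => ENNReal.ofReal (y ^ (m + 1) * Real.exp (-y)) * J) y := by
    intro y
    by_cases hy : y ∈ Ioi 0
    · have hy0 : 0 < y := hy
      rw [indicator_of_mem hy, lintegral_eq_mul_lintegral_smul _ hy0,
        ENNReal.ofReal_mul (by positivity), mul_assoc]
      · congr 1
        rw [hJ, ← lintegral_const_mul' _ _ ENNReal.ofReal_ne_top,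
          ← lintegral_indicator (measurableSet_openSimplex _ _)]
        refine lintegral_congr fun u => ?_
        rw [Fin.insertNth_last']
        have h2 := snoc_mem_openChamber (t := y • u) (z := y)
        rw [smul_mem_openSimplex hy0] at h2
        by_cases hu : u ∈ openSimplex (m + 1) 1
        · rw [indicator_of_mem hu, indicator_of_mem (h2.2 ⟨hy, hu⟩),
            spacingRatio_tailInv ξ hy0 fun i => (hu.2 i).1, Fin.snoc_last, mul_comm]
        · rw [indicator_of_notMem hu, indicator_of_notMem fun h => hu (h2.1 h).2]
      · exact hG.comp ((measurable_insertNth (Fin.last (m + 1))).comp measurable_prodMk_left)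
    · rw [indicator_of_notMem hy]
      refine (lintegral_congr fun t => ?_).trans lintegral_zero
      rw [Fin.insertNth_last']
      exact indicator_of_notMem (fun h => hy (snoc_mem_openChamber.1 h).1) _
  simp only [h1]
  rw [lintegral_indicator measurableSet_Ioi, lintegral_mul_const _ (by fun_prop),
    lintegral_pow_mul_exp_neg]
  congr 3
  push_cast
  ring_nf

lemma image_tail_reverseChamber {d : ℕ} {ξ : ℝ} (hξ : 0 ≤ ξ) :
    (fun (x : Fin d → ℝ) i => tail ξ (x i)) '' reverseChamber d = openSimplex d 1 := by
  ext u
  constructor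
  · rintro ⟨x, ⟨hx, hx0⟩, rfl⟩
    exact ⟨fun i j hij => tail_lt_tail hξ (one_add_mul_pos hξ (hx0 j).le) (hx hij),
      fun i => ⟨tail_pos _ _, tail_lt_one hξ (hx0 i)⟩⟩
  · rintro ⟨hu, hu0⟩
    exact ⟨fun i => tailInv ξ (u i),
      ⟨fun i j hij => tailInv_lt_tailInv hξ (hu0 i).1 (hu hij),
        fun i => tailInv_pos hξ (hu0 i).1 (hu0 i).2⟩,
      funext fun i => tail_tailInv ξ (hu0 i).1⟩

/-- First `u i = tail ξ (x i)`, which maps decreasing positive vectors onto the increasing simplex,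
with Jacobian the product of the `tailDensity`. Then scale by the largest coordinate: `x = (s, s w)`
contributes `s ^ m`. -/
lemma lintegral_openSimplex_tailInv {m : ℕ} {ξ : ℝ} (hξ : 0 ≤ ξ) {ψ : (Fin m → ℝ) → ℝ≥0∞}
    (hψ : Measurable ψ) :
    ∫⁻ u in openSimplex (m + 1) 1, ψ (fun i => tailInv ξ (u i.succ) / tailInv ξ (u 0)) =
      ∫⁻ s in Ioi (0 : ℝ), ∫⁻ w in reverseSimplex m 1, ψ w * ENNReal.ofReal
        (s ^ m * (tailDensity ξ s * ∏ i, tailDensity ξ (w i * s))) := by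
  have htd : ∀ x, ENNReal.ofReal |-tailDensity ξ x| = ENNReal.ofReal (tailDensity ξ x) :=
    fun x => by rw [abs_neg, abs_of_pos (tailDensity_pos ξ x)]
  have hm1 : Measurable (tailDensity ξ) := measurable_tailDensity.comp measurable_prodMk_left
  rw [← image_tail_reverseChamber hξ, lintegral_image_coordinatewise
    (measurableSet_reverseChamber _) (φ' := fun x => -tailDensity ξ x) (I := Ioi 0)
    (fun x hx i => hx.2 i)
    (fun x hx y hy hxy => by
      rw [← tailInv_tail (one_add_mul_pos hξ (le_of_lt (mem_Ioi.1 hx))), hxy,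
        tailInv_tail (one_add_mul_pos hξ (le_of_lt (mem_Ioi.1 hy)))])
    (fun x hx => hasDerivAt_tail (one_add_mul_pos hξ (le_of_lt (mem_Ioi.1 hx))))]
  have h0 : ∫⁻ x in reverseChamber (m + 1), (∏ i, ENNReal.ofReal |-tailDensity ξ (x i)|) *
        ψ (fun i => tailInv ξ (tail ξ (x i.succ)) / tailInv ξ (tail ξ (x 0))) =
      ∫⁻ x in reverseChamber (m + 1), (∏ i, ENNReal.ofReal (tailDensity ξ (x i))) *
        ψ (fun i => x i.succ / x 0) := by
    refine setLIntegral_congr_fun (measurableSet_reverseChamber _) fun x hx => ?_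
    simp only [htd]
    congr 2
    funext i
    rw [tailInv_tail (one_add_mul_pos hξ (hx.2 _).le), tailInv_tail (one_add_mul_pos hξ (hx.2 _).le)]
  rw [h0]
  have hg : Measurable fun x : Fin (m + 1) → ℝ => (∏ i, ENNReal.ofReal (tailDensity ξ (x i))) *
      ψ (fun i => x i.succ / x 0) := by
    refine (Finset.measurable_prod _ fun i _ =>
      (hm1.comp (measurable_pi_apply i)).ennreal_ofReal).mul (hψ.comp ?_)
    exact measurable_pi_iff.2 fun i => (measurable_pi_apply _).div (measurable_pi_apply _)
  have hG := hg.indicator (measurableSet_reverseChamber (m + 1))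
  rw [← lintegral_indicator (measurableSet_reverseChamber _), lintegral_insertNth 0 hG,
    ← lintegral_indicator measurableSet_Ioi]
  refine lintegral_congr fun y => ?_
  by_cases hy : y ∈ Ioi 0
  · have hy0 : 0 < y := hy
    rw [indicator_of_mem hy, lintegral_eq_mul_lintegral_smul _ hy0,
      ← lintegral_const_mul' _ _ ENNReal.ofReal_ne_top,
      ← lintegral_indicator (measurableSet_reverseSimplex _ _)]
    · refine lintegral_congr fun u => ?_
      rw [Fin.insertNth_zero']
      have h2 := cons_mem_reverseChamber (t := y • u) (z := y)
      rw [smul_mem_reverseSimplex hy0] at h2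
      by_cases hu : u ∈ reverseSimplex m 1
      · rw [indicator_of_mem hu, indicator_of_mem (h2.2 ⟨hy, hu⟩), Fin.prod_univ_succ,
          ENNReal.ofReal_mul (by positivity), ENNReal.ofReal_mul (tailDensity_pos _ _).le,
          ENNReal.ofReal_prod_of_nonneg (fun i _ => (tailDensity_pos _ _).le)]
        simp only [Fin.cons_zero, Fin.cons_succ, Pi.smul_apply, smul_eq_mul,
          mul_div_cancel_left₀ _ hy0.ne', mul_comm (u _) y]
        ring
      · rw [indicator_of_notMem hu, indicator_of_notMem (fun h => hu (h2.1 h).2), mul_zero]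
    · exact hG.comp ((measurable_insertNth 0).comp measurable_prodMk_left)
  · rw [indicator_of_notMem hy]
    refine (lintegral_congr fun t => ?_).trans lintegral_zero
    rw [Fin.insertNth_zero']
    exact indicator_of_notMem (fun h => hy (cons_mem_reverseChamber.1 h).1) _

lemma measurable_densityKernel_completeVec (m : ℕ) :
    Measurable fun z : ((Fin m → ℝ) × ℝ) × ℝ => ENNReal.ofReal
      (z.2 ^ m * (tailDensity z.1.2 z.2 * ∏ i, tailDensity z.1.2 (z.1.1 i * z.2))) := by
  refine ((measurable_snd.pow_const m).mul (Measurable.mul ?_ (Finset.measurable_prod _ fun i _ => ?_))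
    ).ennreal_ofReal
  · exact measurable_tailDensity.comp (f := fun z : ((Fin m → ℝ) × ℝ) × ℝ => (z.1.2, z.2))
      (by fun_prop)
  · exact measurable_tailDensity.comp
      (f := fun z : ((Fin m → ℝ) × ℝ) × ℝ => (z.1.2, z.1.1 i * z.2)) (by fun_prop)

lemma measurable_limitDensity_completeVec (m : ℕ) :
    Measurable fun z : (Fin m → ℝ) × ℝ => limitDensity (completeVec (m + 2) z.1) z.2 := by
  simp only [limitDensity_completeVec]
  exact (measurable_densityKernel_completeVec m).lintegral_prod_right'.const_mul _

/-- The law of the self-normalized extreme value vector has density `limitDensity`. -/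
theorem lintegral_openChamber_eq {m : ℕ} {ξ : ℝ} (hξ : 0 ≤ ξ) {ψ : (Fin m → ℝ) → ℝ≥0∞}
    (hψ : Measurable ψ) :
    ∫⁻ s in openChamber (m + 2), ψ (spacingRatio m fun i => tailInv ξ (s i)) *
        ENNReal.ofReal (Real.exp (-s (Fin.last (m + 1)))) =
      ∫⁻ w in reverseSimplex m 1, ψ w * limitDensity (completeVec (m + 2) w) ξ := by
  have hk : Measurable fun z : ℝ × (Fin m → ℝ) => ENNReal.ofReal
      (z.1 ^ m * (tailDensity ξ z.1 * ∏ i, tailDensity ξ (z.2 i * z.1))) :=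
    (measurable_densityKernel_completeVec m).comp
      (f := fun z : ℝ × (Fin m → ℝ) => ((z.2, ξ), z.1)) (by fun_prop)
  rw [lintegral_openChamber_peel hψ, lintegral_openSimplex_tailInv hξ hψ, lintegral_lintegral_swap,
    ← lintegral_const_mul' _ _ ENNReal.ofReal_ne_top]
  · refine lintegral_congr fun w => ?_
    have hkw : Measurable fun s : ℝ => ENNReal.ofReal
        (s ^ m * (tailDensity ξ s * ∏ i, tailDensity ξ (w i * s))) :=
      hk.comp (f := fun s : ℝ => (s, w)) (by fun_prop)
    rw [lintegral_const_mul _ hkw, limitDensity_completeVec]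
    ring
  · exact ((hψ.comp measurable_snd).mul hk).aemeasurable

/-- With the constant function the peeled integral is `Γ(m + 2)` times the volume `1 / (m + 1)!` of
the simplex. -/
theorem lintegral_reverseSimplex_limitDensity (m : ℕ) {ξ : ℝ} (hξ : 0 ≤ ξ) :
    ∫⁻ w in reverseSimplex m 1, limitDensity (completeVec (m + 2) w) ξ = 1 := by
  have h := lintegral_openChamber_eq (m := m) hξ (ψ := fun _ => 1) measurable_const
  rw [lintegral_openChamber_peel (ξ := ξ) (ψ := fun _ => 1) measurable_const] at h
  simp only [one_mul, lintegral_one, Measure.restrict_apply_univ] at h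
  rw [← h, volume_openSimplex _ _ zero_le_one, ← ENNReal.ofReal_mul (Real.Gamma_pos_of_pos
    (by positivity)).le]
  have : Real.Gamma (m + 2) = (m + 1).factorial := by
    rw [← Real.Gamma_nat_eq_factorial]
    push_cast
    ring_nf
  rw [this, one_pow, mul_one_div_cancel (by positivity), ENNReal.ofReal_one]

/-! ### Zero sets of separately analytic functions -/

/-- Cauchy's estimate on circles of radius `R` turns a bound on the integrand into the bound `bound
/ R` on its derivative, so no separate domination of the derivative is needed. -/
lemma hasDerivAt_integral_of_dominated_of_differentiableOn {α : Type*} [MeasurableSpace α]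
    {μ : Measure α} {F : ℂ → α → ℂ} {z₀ : ℂ} {R : ℝ} (hR : 0 < R) {bound : α → ℝ}
    (hF : ∀ z, AEStronglyMeasurable (F z) μ)
    (hd : ∀ᵐ a ∂μ, DifferentiableOn ℂ (fun z => F z a) (Metric.ball z₀ (3 * R)))
    (hb : ∀ᵐ a ∂μ, ∀ z ∈ Metric.ball z₀ (3 * R), ‖F z a‖ ≤ bound a) (hbi : Integrable bound μ) :
    DifferentiableAt ℂ (fun z => ∫ a, F z a ∂μ) z₀ := by
  have hz₀ : z₀ ∈ Metric.ball z₀ (3 * R) := Metric.mem_ball_self (by positivity)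
  have hsub : ∀ z ∈ Metric.ball z₀ R, Metric.closedBall z R ⊆ Metric.ball z₀ (3 * R) := by
    intro z hz w hw
    rw [Metric.mem_ball] at *
    rw [Metric.mem_closedBall] at hw
    linarith [dist_triangle w z z₀]
  have hda : ∀ᵐ a ∂μ, ∀ z ∈ Metric.ball z₀ (3 * R),
      HasDerivAt (fun z => F z a) (deriv (fun z => F z a) z) z := by
    filter_upwards [hd] with a ha z hz
    exact (ha.differentiableAt (Metric.isOpen_ball.mem_nhds hz)).hasDerivAt
  -- The derivative at `z₀` is a limit of measurable difference quotients along `z₀ + 1 / (n + 1)`.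
  have hmeas : AEStronglyMeasurable (fun a => deriv (fun z => F z a) z₀) μ := by
    have hu : Tendsto (fun n : ℕ => (1 / ((n : ℝ) + 1) : ℝ)) atTop (𝓝 0) :=
      tendsto_one_div_add_atTop_nhds_zero_nat
    have hu' : Tendsto (fun n : ℕ => z₀ + ((1 / ((n : ℝ) + 1) : ℝ) : ℂ)) atTop (𝓝[≠] z₀) := by
      refine tendsto_nhdsWithin_iff.2 ⟨?_, Eventually.of_forall fun n => ?_⟩
      · simpa using (tendsto_const_nhds (x := z₀)).add
          ((Complex.continuous_ofReal.tendsto 0).comp hu)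
      · have : (n : ℝ) + 1 ≠ 0 := by positivity
        simp only [mem_compl_iff, mem_singleton_iff, add_eq_left, Complex.ofReal_eq_zero]
        positivity
    refine aestronglyMeasurable_of_tendsto_ae atTop
      (f := fun (n : ℕ) a => slope (fun z => F z a) z₀ (z₀ + ((1 / ((n : ℝ) + 1) : ℝ) : ℂ)))
      (fun n => ?_) ?_
    · simp only [slope_def_field, div_eq_mul_inv]
      exact ((hF _).sub (hF _)).mul_const _
    · filter_upwards [hda] with a ha
      exact (hasDerivAt_iff_tendsto_slope.1 (ha z₀ hz₀)).comp hu'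
  have hbound : ∀ᵐ a ∂μ, ∀ z ∈ Metric.ball z₀ R, ‖deriv (fun z => F z a) z‖ ≤ bound a / R := by
    filter_upwards [hd, hb] with a ha hba z hz
    refine Complex.norm_deriv_le_of_forall_mem_sphere_norm_le hR
      (DifferentiableOn.diffContOnCl ?_) fun w hw => ?_
    · exact ha.mono (Metric.closure_ball_subset_closedBall.trans (hsub z hz))
    · exact hba w (hsub z hz (Metric.sphere_subset_closedBall hw))
  have hF₀ : Integrable (F z₀) μ := by
    refine hbi.mono' (hF z₀) ?_
    filter_upwards [hb] with a ha using ha z₀ hz₀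
  refine (hasDerivAt_integral_of_dominated_loc_of_deriv_le
    (F' := fun z a => deriv (fun z => F z a) z) (Metric.ball_mem_nhds z₀ hR)
    (Eventually.of_forall hF) hF₀ hmeas hbound (hbi.div_const R) ?_).2.differentiableAt
  filter_upwards [hda] with a ha z hz
  exact ha z (Metric.ball_subset_ball (by linarith) hz)

/-- If the zeros accumulate at a positive point, the identity theorem kills `H` on the half-plane.
Otherwise every positive zero is isolated, and the zero set is locally null. -/
lemma forall_eq_zero_or_volume_zeros_eq_zero {H : ℂ → ℂ} {h : ℝ → ℝ}
    (hH : DifferentiableOn ℂ H {z | 0 < z.re}) (hh : ∀ x : ℝ, 0 < x → H x = h x) :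
    (∀ x, 0 < x → h x = 0) ∨ volume {x : ℝ | 0 < x ∧ h x = 0} = 0 := by
  have hopen : IsOpen {z : ℂ | 0 < z.re} := isOpen_lt continuous_const Complex.continuous_re
  have hconv : Convex ℝ {z : ℂ | 0 < z.re} := convex_halfSpace_re_gt 0
  have han : AnalyticOnNhd ℂ H {z | 0 < z.re} := hH.analyticOnNhd hopen
  by_cases hz : ∃ x : ℝ, 0 < x ∧ ∃ᶠ y in 𝓝[≠] x, h y = 0
  · left
    obtain ⟨x, hx, hf⟩ := hz
    have hcast : Tendsto (fun y : ℝ => (y : ℂ)) (𝓝[≠] x) (𝓝[≠] (x : ℂ)) := by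
      refine tendsto_nhdsWithin_iff.2
        ⟨(Complex.continuous_ofReal.tendsto x).mono_left nhdsWithin_le_nhds, ?_⟩
      filter_upwards [self_mem_nhdsWithin] with y hy
      simpa using hy
    have hpos : ∀ᶠ y in 𝓝[≠] x, 0 < y := (lt_mem_nhds hx).filter_mono nhdsWithin_le_nhds
    have hfr : ∃ᶠ z in 𝓝[≠] (x : ℂ), H z = 0 := by
      refine hcast.frequently ((hf.and_eventually hpos).mono fun y hy => ?_)
      rw [hh y hy.2, hy.1, Complex.ofReal_zero]
    have := han.eqOn_zero_of_preconnected_of_frequently_eq_zero hconv.isPreconnected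
      (show (x : ℂ) ∈ {z : ℂ | 0 < z.re} from hx) hfr
    intro y hy
    have h1 := this (show (y : ℂ) ∈ {z : ℂ | 0 < z.re} from hy)
    rw [hh y hy] at h1
    exact Complex.ofReal_eq_zero.1 h1
  · right
    push Not at hz
    refine measure_null_of_locally_null _ fun x hx => ?_
    have h1 := hz x hx.1
    rw [eventually_nhdsWithin_iff] at h1
    refine ⟨{x}, ?_, measure_singleton x⟩
    rw [mem_nhdsWithin_iff_eventually]
    filter_upwards [h1] with y hy hy2
    by_contra hne
    exact hy hne hy2.2

/-- Fix `w₀` with `h w₀ ≠ 0`. By induction the slice with first coordinate `w₀ 0` vanishes only for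
a null set of remaining coordinates `t`. For any other positive `t` the line in the first coordinate
contains a nonzero value, hence has null zero set. Fubini concludes. -/
lemma forall_eq_zero_or_volume_zeros_eq_zero_of_separately {m : ℕ} (h : (Fin m → ℝ) → ℝ)
    (hm : Measurable h)
    (hsep : ∀ w : Fin m → ℝ, (∀ i, 0 < w i) → ∀ i,
      (∀ x, 0 < x → h (Function.update w i x) = 0) ∨
        volume {x : ℝ | 0 < x ∧ h (Function.update w i x) = 0} = 0) :
    (∀ w, (∀ i, 0 < w i) → h w = 0) ∨ volume {w | (∀ i, 0 < w i) ∧ h w = 0} = 0 := by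
  induction m with
  | zero =>
    by_cases h0 : h 0 = 0
    · exact Or.inl fun w _ => by rwa [Subsingleton.elim w 0]
    · right
      refine measure_mono_null (fun w hw => h0 ?_) (measure_empty (μ := volume))
      rw [← Subsingleton.elim w 0]
      exact hw.2
  | succ m ih =>
    by_cases hall : ∀ w, (∀ i, 0 < w i) → h w = 0
    · exact Or.inl hall
    right
    push Not at hall
    obtain ⟨w₀, hw₀, hne⟩ := hall
    have hcons : ∀ x : ℝ, Measurable fun t : Fin m → ℝ => (Fin.cons x t : Fin (m + 1) → ℝ) := by
      intro x
      have := (measurable_insertNth (n := m) 0).comp (measurable_prodMk_left (x := x))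
      simpa only [Function.comp_def, Fin.insertNth_zero'] using this
    have hpos : ∀ (x : ℝ) (t : Fin m → ℝ), (∀ i, 0 < (Fin.cons x t : Fin (m + 1) → ℝ) i) ↔
        0 < x ∧ ∀ i, 0 < t i := fun x t => by simp [Fin.forall_fin_succ]
    have hslice : volume {t : Fin m → ℝ | (∀ i, 0 < t i) ∧ h (Fin.cons (w₀ 0) t) = 0} = 0 := by
      refine (ih (fun t => h (Fin.cons (w₀ 0) t)) (hm.comp (hcons _)) ?_).resolve_left ?_
      · intro t ht i
        have := hsep (Fin.cons (w₀ 0) t) ((hpos _ _).2 ⟨hw₀ 0, ht⟩) i.succ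
        simpa only [← Fin.cons_update] using this
      · intro hcon
        refine hne ?_
        have := hcon (Fin.tail w₀) fun i => hw₀ i.succ
        rwa [Fin.cons_self_tail] at this
    set S : Set (Fin (m + 1) → ℝ) := {w | (∀ i, 0 < w i) ∧ h w = 0} with hS
    have hSm : MeasurableSet S :=
      (measurableSet_forall_pos _).inter (hm (measurableSet_singleton 0))
    have hmp := (volume_preserving_piFinSuccAbove (fun _ : Fin (m + 1) => ℝ) 0).symm
    rw [← hmp.measure_preimage hSm.nullMeasurableSet, Measure.volume_eq_prod,
      Measure.prod_apply_symm (hmp.measurable hSm), lintegral_eq_zero_iff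
        (measurable_measure_prodMk_right (hmp.measurable hSm))]
    have hae := measure_eq_zero_iff_ae_notMem.1 hslice
    filter_upwards [hae] with t ht
    have hpre : (fun x : ℝ => (x, t)) ⁻¹' ((MeasurableEquiv.piFinSuccAbove
        (fun _ : Fin (m + 1) => ℝ) 0).symm ⁻¹' S) =
        {x | (Fin.cons x t : Fin (m + 1) → ℝ) ∈ S} := by
      ext x
      simp only [mem_preimage, mem_ofPred_eq, ← Fin.insertNth_zero']
      rfl
    rw [hpre]
    by_cases htp : ∀ i, 0 < t i
    · have h1 := (hsep (Fin.cons (w₀ 0) t) ((hpos _ _).2 ⟨hw₀ 0, htp⟩) 0).resolve_left (by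
        intro hcon
        have := hcon (w₀ 0) (hw₀ 0)
        rw [Fin.update_cons_zero] at this
        exact ht ⟨htp, this⟩)
      simp only [Fin.update_cons_zero] at h1
      refine measure_mono_null (fun x hx => ?_) h1
      exact ⟨((hpos x t).1 hx.1).1, hx.2⟩
    · exact measure_mono_null (fun x hx => htp ((hpos x t).1 hx.1).2)
        (measure_empty (μ := volume))

/-! ### Mixtures of limiting densities -/

/-- The extension of `tailDensity ξ` to complex arguments. -/
def complexTailDensity (ξ : ℝ) (z : ℂ) : ℂ :=
  if ξ = 0 then Complex.exp (-z)
  else Complex.exp (((-1 - 1 / ξ : ℝ) : ℂ) * Complex.log (1 + ξ * z))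

lemma measurable_complexTailDensity :
    Measurable fun p : ℝ × ℂ => complexTailDensity p.1 p.2 := by
  unfold complexTailDensity
  refine Measurable.ite (measurable_fst (measurableSet_singleton 0)) ?_ ?_
  · fun_prop
  · refine Complex.measurable_exp.comp (Measurable.mul ?_ (Complex.measurable_log.comp ?_))
    · exact Complex.measurable_ofReal.comp (by fun_prop)
    · exact measurable_const.add ((Complex.measurable_ofReal.comp measurable_fst).mul measurable_snd)

lemma one_add_mul_re_pos {ξ : ℝ} (hξ : 0 ≤ ξ) {z : ℂ} (hz : 0 < z.re) :
    0 < (1 + ξ * z : ℂ).re := by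
  simpa using one_add_mul_pos hξ hz.le

/-- The exponent is real and negative and `|1 + ξ z| ≥ 1 + ξ Re z`, so real bounds dominate the
complex extension. -/
lemma norm_complexTailDensity_le {ξ : ℝ} (hξ : 0 ≤ ξ) {z : ℂ} (hz : 0 < z.re) :
    ‖complexTailDensity ξ z‖ ≤ tailDensity ξ z.re := by
  unfold complexTailDensity tailDensity
  split_ifs with h
  · rw [Complex.norm_exp, Complex.neg_re]
  · have hp : 0 < ξ := lt_of_le_of_ne hξ (Ne.symm h)
    have h1 := one_add_mul_re_pos hξ hz
    rw [Complex.norm_exp, Complex.re_ofReal_mul, Complex.log_re]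
    have h2 : Real.log (1 + ξ * z.re) ≤ Real.log ‖(1 + ξ * z : ℂ)‖ := by
      refine Real.log_le_log (one_add_mul_pos hξ hz.le) ?_
      simpa using Complex.re_le_norm (1 + ξ * z : ℂ)
    have h3 : 0 < 1 / ξ := by positivity
    exact Real.exp_le_exp.2 (by nlinarith)

lemma complexTailDensity_ofReal {ξ x : ℝ} (hξ : 0 ≤ ξ) (hx : 0 < x) :
    complexTailDensity ξ x = tailDensity ξ x := by
  unfold complexTailDensity tailDensity
  split_ifs with h
  · push_cast; rfl
  · rw [show (1 + ξ * x : ℂ) = ((1 + ξ * x : ℝ) : ℂ) by push_cast; rfl,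
      ← Complex.ofReal_log (one_add_mul_pos hξ hx.le).le]
    push_cast
    rfl

lemma differentiableAt_complexTailDensity {ξ : ℝ} (hξ : 0 ≤ ξ) {z : ℂ} (hz : 0 < z.re) :
    DifferentiableAt ℂ (complexTailDensity ξ) z := by
  unfold complexTailDensity
  split_ifs with h
  · fun_prop
  · have h1 : (1 + ξ * z : ℂ) ∈ Complex.slitPlane := Or.inl (one_add_mul_re_pos hξ hz)
    have h2 : DifferentiableAt ℂ (fun z : ℂ => 1 + (ξ : ℂ) * z) z := by fun_prop
    exact ((h2.clog h1).const_mul _).cexp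

/-- The joint kernel of the limiting density. -/
def jointKernel (m : ℕ) (w : Fin m → ℝ) (z : ℝ × ℝ) : ℝ :=
  z.2 ^ m * (tailDensity z.1 z.2 * ∏ i, tailDensity z.1 (w i * z.2))

/-- The reference measure of the joint kernel. -/
def jointMeasure (P : Measure ℝ) : Measure (ℝ × ℝ) := P.prod (volume.restrict (Ioi 0))

/-- A dominating function of the joint kernel. -/
def jointBound (m : ℕ) (c : ℝ) (z : ℝ × ℝ) : ℝ :=
  8 * (8 / c) ^ m * tailDensity 2 (c * z.2)

lemma measurable_jointKernel (m : ℕ) (w : Fin m → ℝ) : Measurable (jointKernel m w) := by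
  refine (measurable_snd.pow_const m).mul
    (Measurable.mul measurable_tailDensity (Finset.measurable_prod _ fun i _ => ?_))
  exact measurable_tailDensity.comp (f := fun z : ℝ × ℝ => (z.1, w i * z.2)) (by fun_prop)

lemma jointKernel_nonneg (m : ℕ) (w : Fin m → ℝ) {z : ℝ × ℝ} (hz : 0 < z.2) :
    0 ≤ jointKernel m w z := by
  have h : ∀ x, 0 ≤ tailDensity z.1 x := fun x => (tailDensity_pos _ _).le
  exact mul_nonneg (by positivity) (mul_nonneg (h _) (Finset.prod_nonneg fun i _ => h _))

lemma tailDensity_two {x : ℝ} (hx : 0 ≤ x) :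
    tailDensity 2 x = (1 + 2 * x) ^ (-(3 / 2) : ℝ) := by
  rw [Real.rpow_def_of_pos (by linarith), tailDensity]
  norm_num
  ring

lemma mul_tailDensity_two_le {x : ℝ} (hx : 0 ≤ x) : x * tailDensity 2 x ≤ 1 := by
  have h1 : tailDensity 2 x ≤ (1 + 2 * x)⁻¹ := by
    rw [tailDensity_two hx, ← Real.rpow_neg_one]
    exact Real.rpow_le_rpow_of_exponent_le (by linarith) (by norm_num)
  calc x * tailDensity 2 x ≤ x * (1 + 2 * x)⁻¹ := by gcongr
    _ ≤ 1 := by rw [← div_eq_mul_inv, div_le_one (by linarith)]; linarith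

/-- Each of the `m` factors with `w i ≥ c` absorbs one power of `s`, since `s * tailDensity 2 (c s)
≤ 1 / c`. The remaining factor decays like `s ^ (-3/2)` and supplies integrability. The bound is
uniform over `w i ≥ c` and over the index. -/
lemma jointKernel_le {m : ℕ} {w : Fin m → ℝ} {c : ℝ} (hc : 0 < c) (hc1 : c ≤ 1)
    (hw : ∀ i, c ≤ w i) {z : ℝ × ℝ} (hz1 : z.1 ∈ Icc 0 2) (hz2 : 0 < z.2) :
    jointKernel m w z ≤ jointBound m c z := by
  obtain ⟨ξ, s⟩ := z
  obtain ⟨h0, h2⟩ : 0 ≤ ξ ∧ ξ ≤ 2 := hz1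
  replace hz2 : 0 < s := hz2
  have hcs : 0 ≤ c * s := by positivity
  have hk : ∀ x, c ≤ x → tailDensity ξ (x * s) ≤ 8 * tailDensity 2 (c * s) := fun x hx =>
    (tailDensity_anti h0 hcs (by gcongr)).trans (tailDensity_le h0 h2 hcs)
  have hp := tailDensity_pos 2 (c * s)
  have h1 : ∏ i, tailDensity ξ (w i * s) ≤ (8 * tailDensity 2 (c * s)) ^ m := by
    calc _ ≤ ∏ _i : Fin m, 8 * tailDensity 2 (c * s) :=
          Finset.prod_le_prod (fun i _ => (tailDensity_pos _ _).le) fun i _ => hk _ (hw i)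
      _ = _ := by simp
  have h3 : s * (8 * tailDensity 2 (c * s)) ≤ 8 / c := by
    rw [le_div_iff₀ hc]
    nlinarith [mul_tailDensity_two_le hcs]
  have h4 : tailDensity ξ s ≤ 8 * tailDensity 2 (c * s) := by simpa using hk 1 hc1
  calc jointKernel m w (ξ, s)
      ≤ s ^ m * ((8 * tailDensity 2 (c * s)) * (8 * tailDensity 2 (c * s)) ^ m) := by
        have := (tailDensity_pos ξ s).le
        have h5 : 0 ≤ ∏ i, tailDensity ξ (w i * s) :=
          Finset.prod_nonneg fun i _ => (tailDensity_pos _ _).le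
        unfold jointKernel
        dsimp only
        gcongr
    _ = (s * (8 * tailDensity 2 (c * s))) ^ m * (8 * tailDensity 2 (c * s)) := by
        rw [mul_pow]; ring
    _ ≤ (8 / c) ^ m * (8 * tailDensity 2 (c * s)) := by gcongr
    _ = jointBound m c (ξ, s) := by unfold jointBound; ring

lemma integrable_jointBound (m : ℕ) {c : ℝ} (hc : 0 < c) (P : Measure ℝ) [IsFiniteMeasure P] :
    Integrable (jointBound m c) (jointMeasure P) := by
  have h1 : Integrable (fun x : ℝ => (1 + ‖x‖) ^ (-(3 / 2) : ℝ)) volume :=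
    integrable_one_add_norm (by simp; norm_num)
  have h2 := (h1.comp_mul_left' (show 2 * c ≠ 0 by positivity)).restrict (s := Ioi 0)
  have h3 : Integrable (fun s => tailDensity 2 (c * s)) (volume.restrict (Ioi 0)) := by
    refine h2.congr ?_
    filter_upwards [ae_restrict_mem measurableSet_Ioi] with s hs
    have hs0 : 0 < s := hs
    rw [tailDensity_two (by positivity), Real.norm_of_nonneg (by positivity), mul_assoc]
  exact (h3.comp_snd P).const_mul _

lemma ae_jointMeasure {P : Measure ℝ} [IsFiniteMeasure P] (hP : ∀ᵐ ξ ∂P, ξ ∈ Icc (0 : ℝ) 2) :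
    ∀ᵐ z ∂jointMeasure P, z.1 ∈ Icc (0 : ℝ) 2 ∧ 0 < z.2 :=
  (Measure.quasiMeasurePreserving_fst.ae hP).and
    (Measure.quasiMeasurePreserving_snd.ae (ae_restrict_mem measurableSet_Ioi))

lemma exists_pos_le {m : ℕ} {w : Fin m → ℝ} (hw : ∀ i, 0 < w i) :
    ∃ c, 0 < c ∧ c ≤ 1 ∧ ∀ i, c < w i := by
  have h1 : ∀ᶠ c in 𝓝[>] (0 : ℝ), c ∈ Ioo 0 1 ∧ ∀ i, c ∈ Ioo 0 (w i) :=
    Eventually.and (Ioo_mem_nhdsGT one_pos) (eventually_all.2 fun i => Ioo_mem_nhdsGT (hw i))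
  obtain ⟨c, hc, hcw⟩ := h1.exists
  exact ⟨c, hc.1, hc.2.le, fun i => (hcw i).2⟩

lemma integrable_jointKernel {m : ℕ} {w : Fin m → ℝ} (hw : ∀ i, 0 < w i) {P : Measure ℝ}
    [IsFiniteMeasure P] (hP : ∀ᵐ ξ ∂P, ξ ∈ Icc (0 : ℝ) 2) :
    Integrable (jointKernel m w) (jointMeasure P) := by
  obtain ⟨c, hc, hc1, hcw⟩ := exists_pos_le hw
  refine (integrable_jointBound m hc P).mono' (measurable_jointKernel m w).aestronglyMeasurable ?_
  filter_upwards [ae_jointMeasure hP] with z hz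
  rw [Real.norm_of_nonneg (jointKernel_nonneg m w hz.2)]
  exact jointKernel_le hc hc1 (fun i => (hcw i).le) hz.1 hz.2

lemma continuousAt_tailDensity {ξ x : ℝ} (hξ : 0 ≤ ξ) (hx : 0 < x) :
    ContinuousAt (tailDensity ξ) x := by
  unfold tailDensity
  split_ifs with h
  · fun_prop
  · have := one_add_mul_pos hξ hx.le
    exact ContinuousAt.rexp (continuousAt_const.mul
      (ContinuousAt.log (by fun_prop) this.ne'))

lemma continuousAt_integral_jointKernel {m : ℕ} {w : Fin m → ℝ} (hw : ∀ i, 0 < w i)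
    {P : Measure ℝ} [IsFiniteMeasure P] (hP : ∀ᵐ ξ ∂P, ξ ∈ Icc (0 : ℝ) 2) :
    ContinuousAt (fun w => ∫ z, jointKernel m w z ∂jointMeasure P) w := by
  obtain ⟨c, hc, hc1, hcw⟩ := exists_pos_le hw
  refine continuousAt_of_dominated (bound := jointBound m c)
    (Eventually.of_forall fun w => (measurable_jointKernel m w).aestronglyMeasurable) ?_
    (integrable_jointBound m hc P) ?_
  · have h1 : ∀ᶠ w' in 𝓝 w, ∀ i, c < w' i :=
      eventually_all.2 fun i => (continuous_apply i).tendsto w |>.eventually_const_lt (hcw i)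
    filter_upwards [h1] with w' hw'
    filter_upwards [ae_jointMeasure hP] with z hz
    rw [Real.norm_of_nonneg (jointKernel_nonneg m w' hz.2)]
    exact jointKernel_le hc hc1 (fun i => (hw' i).le) hz.1 hz.2
  · filter_upwards [ae_jointMeasure hP] with z hz
    unfold jointKernel
    refine continuousAt_const.mul (continuousAt_const.mul (tendsto_finsetProd _ fun i _ => ?_))
    have h2 : ContinuousAt (fun w : Fin m → ℝ => w i * z.2) w :=
      ((continuous_apply i).mul continuous_const).continuousAt
    exact ContinuousAt.comp (f := fun w : Fin m → ℝ => w i * z.2)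
      (continuousAt_tailDensity hz.1.1 (mul_pos (hw i) hz.2)) h2

lemma jointKernel_update {m : ℕ} (w : Fin m → ℝ) (i : Fin m) (x : ℝ) (z : ℝ × ℝ) :
    jointKernel m (Function.update w i x) z =
      z.2 ^ m * (tailDensity z.1 z.2 * ∏ j ∈ Finset.univ.erase i, tailDensity z.1 (w j * z.2)) *
        tailDensity z.1 (x * z.2) := by
  unfold jointKernel
  rw [← Finset.mul_prod_erase Finset.univ _ (Finset.mem_univ i), Function.update_self]
  have : ∏ j ∈ Finset.univ.erase i, tailDensity z.1 (Function.update w i x j * z.2) =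
      ∏ j ∈ Finset.univ.erase i, tailDensity z.1 (w j * z.2) :=
    Finset.prod_congr rfl fun j hj => by rw [Function.update_of_ne (Finset.ne_of_mem_erase hj)]
  rw [this]
  ring

/-- In each coordinate, the integral of the joint kernel extends to a holomorphic function on the
right half-plane. -/
lemma exists_differentiableOn_integral_jointKernel {m : ℕ} {w : Fin m → ℝ} (hw : ∀ i, 0 < w i)
    (i : Fin m) {P : Measure ℝ} [IsFiniteMeasure P] (hP : ∀ᵐ ξ ∂P, ξ ∈ Icc (0 : ℝ) 2) :
    ∃ H : ℂ → ℂ, DifferentiableOn ℂ H {z | 0 < z.re} ∧ ∀ x : ℝ, 0 < x →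
      H x = ((∫ z, jointKernel m (Function.update w i x) z ∂jointMeasure P : ℝ) : ℂ) := by
  set G : ℝ × ℝ → ℝ := fun z =>
    z.2 ^ m * (tailDensity z.1 z.2 * ∏ j ∈ Finset.univ.erase i, tailDensity z.1 (w j * z.2)) with hG
  have hGm : Measurable G := by
    refine (measurable_snd.pow_const m).mul
      (Measurable.mul measurable_tailDensity (Finset.measurable_prod _ fun j _ => ?_))
    exact measurable_tailDensity.comp (f := fun z : ℝ × ℝ => (z.1, w j * z.2)) (by fun_prop)
  have hG0 : ∀ z : ℝ × ℝ, 0 < z.2 → 0 ≤ G z := fun z hz =>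
    mul_nonneg (by positivity) (mul_nonneg (tailDensity_pos _ _).le
      (Finset.prod_nonneg fun j _ => (tailDensity_pos _ _).le))
  set F : ℂ → ℝ × ℝ → ℂ := fun ζ z => (G z : ℂ) * complexTailDensity z.1 (ζ * z.2) with hF
  refine ⟨fun ζ => ∫ z, F ζ z ∂jointMeasure P, ?_, fun x hx => ?_⟩
  · intro ζ₀ hζ₀
    have hre : 0 < ζ₀.re := hζ₀
    refine DifferentiableAt.differentiableWithinAt ?_
    obtain ⟨c₀, hc₀, hc1₀, hcw⟩ := exists_pos_le hw
    -- On the ball of radius `3/4 * Re ζ₀` the real part stays above `Re ζ₀ / 4`, so one `c` serves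
    -- the moving coordinate and the fixed ones.
    set c := min c₀ (ζ₀.re / 4) with hc
    have hcpos : 0 < c := lt_min hc₀ (by positivity)
    have hball : ∀ ζ ∈ Metric.ball ζ₀ (3 * (ζ₀.re / 4)), c ≤ ζ.re := by
      intro ζ hζ
      have h1 : |(ζ - ζ₀).re| ≤ ‖ζ - ζ₀‖ := Complex.abs_re_le_norm _
      rw [Metric.mem_ball, dist_eq_norm] at hζ
      have h2 := (abs_le.1 h1).1
      rw [Complex.sub_re] at h2
      have h3 : c ≤ ζ₀.re / 4 := min_le_right _ _
      linarith
    refine hasDerivAt_integral_of_dominated_of_differentiableOn (R := ζ₀.re / 4) (by positivity)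
      (bound := jointBound m c) (fun ζ => ?_) ?_ ?_ (integrable_jointBound m hcpos P)
    · refine Measurable.aestronglyMeasurable ((Complex.measurable_ofReal.comp hGm).mul ?_)
      exact measurable_complexTailDensity.comp (f := fun z : ℝ × ℝ => (z.1, ζ * (z.2 : ℂ)))
        (measurable_fst.prodMk (measurable_const.mul (Complex.measurable_ofReal.comp measurable_snd)))
    · filter_upwards [ae_jointMeasure hP] with z hz ζ hζ
      refine DifferentiableAt.differentiableWithinAt (DifferentiableAt.const_mul ?_ _)
      have h4 : 0 < (ζ * (z.2 : ℂ)).re := by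
        simpa using mul_pos (hcpos.trans_le (hball ζ hζ)) hz.2
      exact DifferentiableAt.comp (f := fun ζ : ℂ => ζ * (z.2 : ℂ)) ζ
        (differentiableAt_complexTailDensity hz.1.1 h4) (by fun_prop)
    · filter_upwards [ae_jointMeasure hP] with z hz ζ hζ
      have h4 : 0 < (ζ * (z.2 : ℂ)).re := by
        simpa using mul_pos (hcpos.trans_le (hball ζ hζ)) hz.2
      have h5 := norm_complexTailDensity_le hz.1.1 h4
      have h6 : (ζ * (z.2 : ℂ)).re = ζ.re * z.2 := by simp
      rw [h6] at h5
      calc ‖F ζ z‖ = G z * ‖complexTailDensity z.1 (ζ * z.2)‖ := by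
            rw [hF, norm_mul, Complex.norm_of_nonneg (hG0 z hz.2)]
        _ ≤ G z * tailDensity z.1 (ζ.re * z.2) := mul_le_mul_of_nonneg_left h5 (hG0 z hz.2)
        -- The complex integrand is bounded by the real kernel at `Re ζ`, to which the real bound
        -- applies.
        _ = jointKernel m (Function.update w i ζ.re) z := (jointKernel_update w i _ z).symm
        _ ≤ jointBound m c z := by
            refine jointKernel_le hcpos ((min_le_left _ _).trans hc1₀) (fun j => ?_) hz.1 hz.2
            by_cases hj : j = i
            · subst hj
              simpa using hball ζ hζ
            · rw [Function.update_of_ne hj]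
              exact (min_le_left _ _).trans (hcw j).le
  · refine (integral_congr_ae ?_).trans integral_complex_ofReal
    filter_upwards [ae_jointMeasure hP] with z hz
    rw [jointKernel_update, hF]
    dsimp only
    rw [← Complex.ofReal_mul x, complexTailDensity_ofReal hz.1.1 (mul_pos hx hz.2)]
    exact (Complex.ofReal_mul _ _).symm

/-- The mixture of the limiting densities with respect to the mixing measure `P`. -/
def mixtureDensity (m : ℕ) (P : Measure ℝ) (w : Fin m → ℝ) : ℝ≥0∞ :=
  ∫⁻ ξ, limitDensity (completeVec (m + 2) w) ξ ∂P

lemma measurable_mixtureDensity (m : ℕ) (P : Measure ℝ) [IsFiniteMeasure P] :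
    Measurable (mixtureDensity m P) :=
  (measurable_limitDensity_completeVec m).lintegral_prod_right'

lemma mixtureDensity_eq_lintegral (m : ℕ) (P : Measure ℝ) [IsFiniteMeasure P] (w : Fin m → ℝ) :
    mixtureDensity m P w = ENNReal.ofReal (Real.Gamma (m + 2)) *
      ∫⁻ z, ENNReal.ofReal (jointKernel m w z) ∂jointMeasure P := by
  unfold mixtureDensity jointMeasure
  rw [lintegral_prod _ (measurable_jointKernel m w).ennreal_ofReal.aemeasurable,
    ← lintegral_const_mul' _ _ ENNReal.ofReal_ne_top]
  simp only [limitDensity_completeVec]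
  rfl

/-- Finiteness on the open positive orthant makes the mixture a Bochner integral, to which
continuity under the integral sign and holomorphy apply. -/
lemma mixtureDensity_eq_ofReal {m : ℕ} {P : Measure ℝ} [IsFiniteMeasure P]
    (hP : ∀ᵐ ξ ∂P, ξ ∈ Icc (0 : ℝ) 2) {w : Fin m → ℝ} (hw : ∀ i, 0 < w i) :
    mixtureDensity m P w = ENNReal.ofReal (Real.Gamma (m + 2) *
      ∫ z, jointKernel m w z ∂jointMeasure P) := by
  rw [mixtureDensity_eq_lintegral, ENNReal.ofReal_mul (Real.Gamma_pos_of_pos (by positivity)).le,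
    ofReal_integral_eq_lintegral_ofReal (integrable_jointKernel hw hP)]
  filter_upwards [ae_jointMeasure hP] with z hz using jointKernel_nonneg m w hz.2

lemma continuousAt_mixtureDensity {m : ℕ} {P : Measure ℝ} [IsFiniteMeasure P]
    (hP : ∀ᵐ ξ ∂P, ξ ∈ Icc (0 : ℝ) 2) {w : Fin m → ℝ} (hw : ∀ i, 0 < w i) :
    ContinuousAt (mixtureDensity m P) w := by
  have h1 : ∀ᶠ w' in 𝓝 w, ∀ i, 0 < w' i :=
    eventually_all.2 fun i => (continuous_apply i).tendsto w |>.eventually_const_lt (hw i)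
  have h2 : ContinuousAt (fun w => ENNReal.ofReal (Real.Gamma (m + 2) *
      ∫ z, jointKernel m w z ∂jointMeasure P)) w :=
    ENNReal.continuous_ofReal.continuousAt.comp
      ((continuousAt_integral_jointKernel hw hP).const_mul _)
  refine h2.congr ?_
  filter_upwards [h1] with w' hw'
  exact (mixtureDensity_eq_ofReal hP hw').symm

/-- Two mixtures of limiting densities agree everywhere or almost nowhere. -/
theorem mixtureDensity_eq_or_volume_eq_zero (m : ℕ) {P Q : Measure ℝ} [IsFiniteMeasure P]
    [IsFiniteMeasure Q] (hP : ∀ᵐ ξ ∂P, ξ ∈ Icc (0 : ℝ) 2) (hQ : ∀ᵐ ξ ∂Q, ξ ∈ Icc (0 : ℝ) 2) :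
    (∀ w : Fin m → ℝ, (∀ i, 0 < w i) → mixtureDensity m P w = mixtureDensity m Q w) ∨
      volume {w : Fin m → ℝ | (∀ i, 0 < w i) ∧ mixtureDensity m P w = mixtureDensity m Q w} = 0 := by
  set h : (Fin m → ℝ) → ℝ := fun w => (mixtureDensity m P w).toReal - (mixtureDensity m Q w).toReal
    with hdef
  have hΓ : 0 < Real.Gamma ((m : ℝ) + 2) := Real.Gamma_pos_of_pos (by positivity)
  have hnn : ∀ {T : Measure ℝ} [IsFiniteMeasure T], (∀ᵐ ξ ∂T, ξ ∈ Icc (0 : ℝ) 2) →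
      ∀ w, 0 ≤ ∫ z, jointKernel m w z ∂jointMeasure T := fun hT w => by
    refine integral_nonneg_of_ae ?_
    filter_upwards [ae_jointMeasure hT] with z hz using jointKernel_nonneg m w hz.2
  have hval : ∀ w : Fin m → ℝ, (∀ i, 0 < w i) → h w = Real.Gamma (m + 2) *
      ((∫ z, jointKernel m w z ∂jointMeasure P) - ∫ z, jointKernel m w z ∂jointMeasure Q) := by
    intro w hw
    rw [hdef]
    dsimp only
    rw [mixtureDensity_eq_ofReal hP hw, mixtureDensity_eq_ofReal hQ hw,
      ENNReal.toReal_ofReal (mul_nonneg hΓ.le (hnn hP w)),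
      ENNReal.toReal_ofReal (mul_nonneg hΓ.le (hnn hQ w)), mul_sub]
  have hiff : ∀ w : Fin m → ℝ, (∀ i, 0 < w i) →
      (h w = 0 ↔ mixtureDensity m P w = mixtureDensity m Q w) := by
    intro w hw
    have h1 : mixtureDensity m P w ≠ ∞ := by
      rw [mixtureDensity_eq_ofReal hP hw]; exact ENNReal.ofReal_ne_top
    have h2 : mixtureDensity m Q w ≠ ∞ := by
      rw [mixtureDensity_eq_ofReal hQ hw]; exact ENNReal.ofReal_ne_top
    rw [hdef, sub_eq_zero, ENNReal.toReal_eq_toReal_iff' h1 h2]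
  have hm : Measurable h :=
    (measurable_mixtureDensity m P).ennreal_toReal.sub (measurable_mixtureDensity m Q).ennreal_toReal
  have hsep : ∀ w : Fin m → ℝ, (∀ i, 0 < w i) → ∀ i,
      (∀ x, 0 < x → h (Function.update w i x) = 0) ∨
        volume {x : ℝ | 0 < x ∧ h (Function.update w i x) = 0} = 0 := by
    intro w hw i
    obtain ⟨H, hH, hHx⟩ := exists_differentiableOn_integral_jointKernel hw i hP
    obtain ⟨K, hK, hKx⟩ := exists_differentiableOn_integral_jointKernel hw i hQ
    refine forall_eq_zero_or_volume_zeros_eq_zero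
      (H := fun z => (Real.Gamma (m + 2) : ℂ) * (H z - K z)) ((hH.sub hK).const_mul _) fun x hx => ?_
    have hpos : ∀ j, 0 < Function.update w i x j := fun j => by
      by_cases hj : j = i
      · subst hj; simpa using hx
      · rw [Function.update_of_ne hj]; exact hw j
    rw [hHx x hx, hKx x hx, hval _ hpos]
    push_cast
    rfl
  rcases forall_eq_zero_or_volume_zeros_eq_zero_of_separately h hm hsep with h0 | h0
  · exact Or.inl fun w hw => (hiff w hw).1 (h0 w hw)
  · refine Or.inr (measure_mono_null (fun w hw => ?_) h0)
    exact ⟨hw.1, (hiff w hw.1).2 hw.2⟩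

/-! ### The test and its limiting level -/

/-- The two sets differ only by ties and by coordinates equal to `0` or `1`: finitely many
hyperplanes. -/
lemma orderedCube_ae_eq_reverseSimplex (m : ℕ) :
    (orderedCube (m + 2) : Set (Fin m → ℝ)) =ᵐ[volume] reverseSimplex m 1 := by
  have hval : ∀ c : ℝ, ∀ᵐ w : Fin m → ℝ, ∀ i, w i ≠ c := fun c =>
    ae_all_iff.2 fun i => Measure.ae_eval_ne (μ := fun _ : Fin m => (volume : Measure ℝ)) i c
  have hties : ∀ᵐ w : Fin m → ℝ, ∀ i j, i ≠ j → w i ≠ w j := by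
    refine ae_all_iff.2 fun i => ae_all_iff.2 fun j => ?_
    by_cases hij : i = j
    · simp [hij]
    set L : (Fin m → ℝ) →ₗ[ℝ] ℝ := LinearMap.proj (R := ℝ) (φ := fun _ : Fin m => ℝ) i -
      LinearMap.proj (R := ℝ) (φ := fun _ : Fin m => ℝ) j
    have hL : LinearMap.ker L ≠ ⊤ := by
      intro h
      have h1 : Pi.single i 1 ∈ LinearMap.ker L := h ▸ Submodule.mem_top
      simp [L, Ne.symm hij] at h1
    filter_upwards [measure_eq_zero_iff_ae_notMem.1 (Measure.addHaar_submodule volume _ hL)]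
      with w hw _ heq
    exact hw (by simp [L, heq])
  filter_upwards [hval 0, hval 1, hties] with w h0 h1 h2
  refine propext ⟨fun h => ?_, fun h => ⟨h.1.antitone, fun i => ⟨(h.2 i).1.le, (h.2 i).2.le⟩⟩⟩
  obtain ⟨ha, hI⟩ : Antitone w ∧ ∀ i, w i ∈ Icc (0 : ℝ) 1 := h
  exact ⟨fun i j hij => lt_of_le_of_ne (ha hij.le) (h2 j i hij.ne'),
    fun i => ⟨lt_of_le_of_ne (hI i).1 (h0 i).symm, lt_of_le_of_ne (hI i).2 (h1 i)⟩⟩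

lemma limitExpectation_eq (m : ℕ) (ξ : ℝ) (ψ : (Fin (m + 2) → ℝ) → ℝ≥0∞) :
    limitExpectation (m + 2) ξ ψ = ∫⁻ w in reverseSimplex m 1,
      ψ (completeVec (m + 2) w) * limitDensity (completeVec (m + 2) w) ξ :=
  setLIntegral_congr (orderedCube_ae_eq_reverseSimplex m)

-- Since the threshold `1` is neither `0` nor `∞`, `1 < N / M` is equivalent to `M < N` in `ℝ≥0∞`
-- even when `M` or `N` is `0` or `∞`.
open Classical in
lemma test_completeVec (m : ℕ) (ε : ℝ) (W Λ : Measure ℝ) (w : Fin m → ℝ) :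
    test ε W Λ (completeVec (m + 2) w) =
      if mixtureDensity m (Λ.restrict (Icc 0 (1 - ε))) w <
        mixtureDensity m (W.restrict (Ioc (1 - ε) 2)) w then 1 else 0 := by
  have h : 1 < likelihoodRatio ε W Λ (completeVec (m + 2) w) ↔
      mixtureDensity m (Λ.restrict (Icc 0 (1 - ε))) w <
        mixtureDensity m (W.restrict (Ioc (1 - ε) 2)) w := by
    unfold likelihoodRatio
    rw [ENNReal.lt_div_iff_mul_lt (Or.inr ENNReal.one_ne_top) (Or.inr one_ne_zero), one_mul]
    rfl
  unfold test
  exact if_congr h rfl rfl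

lemma ae_restrict_Ioc_mem {W : Measure ℝ} {ε : ℝ} (hε : ε < 1) :
    ∀ᵐ ξ ∂W.restrict (Ioc (1 - ε) 2), ξ ∈ Icc (0 : ℝ) 2 := by
  filter_upwards [ae_restrict_mem measurableSet_Ioc] with ξ hξ
  exact ⟨by linarith [hξ.1], hξ.2⟩

lemma ae_restrict_Icc_mem {Λ : Measure ℝ} {ε : ℝ} (hε : 0 < ε) :
    ∀ᵐ ξ ∂Λ.restrict (Icc 0 (1 - ε)), ξ ∈ Icc (0 : ℝ) 2 := by
  filter_upwards [ae_restrict_mem measurableSet_Icc] with ξ hξ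
  exact ⟨hξ.1, by linarith [hξ.2]⟩

lemma limitDensity_completeVec_ne_zero {m : ℕ} (w : Fin m → ℝ) (ξ : ℝ) :
    limitDensity (completeVec (m + 2) w) ξ ≠ 0 := by
  rw [limitDensity_completeVec]
  refine mul_ne_zero (by simpa using Real.Gamma_pos_of_pos (by positivity)) ?_
  have hm : Measurable fun s : ℝ => ENNReal.ofReal
      (s ^ m * (tailDensity ξ s * ∏ i, tailDensity ξ (w i * s))) :=
    (measurable_densityKernel_completeVec m).comp (f := fun s : ℝ => ((w, ξ), s)) (by fun_prop)
  intro h0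
  rw [lintegral_eq_zero_iff hm] at h0
  have h1 : ∀ᵐ s : ℝ ∂volume.restrict (Ioi 0), False := by
    filter_upwards [h0, ae_restrict_mem measurableSet_Ioi] with s hs hs0
    have hs0' : 0 < s := hs0
    have : 0 < s ^ m * (tailDensity ξ s * ∏ i, tailDensity ξ (w i * s)) :=
      mul_pos (by positivity) (mul_pos (tailDensity_pos _ _)
        (Finset.prod_pos fun i _ => tailDensity_pos _ _))
    exact (ENNReal.ofReal_pos.2 this).ne' hs
  rw [eventually_false_iff_eq_bot, ae_eq_bot, Measure.restrict_eq_zero] at h1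
  simp at h1

lemma mixtureDensity_ne_zero {m : ℕ} {P : Measure ℝ} (hP : P ≠ 0) (w : Fin m → ℝ) :
    mixtureDensity m P w ≠ 0 := by
  have hm : Measurable fun ξ => limitDensity (completeVec (m + 2) w) ξ :=
    (measurable_limitDensity_completeVec m).comp (f := fun ξ : ℝ => (w, ξ)) (by fun_prop)
  intro h0
  unfold mixtureDensity at h0
  rw [lintegral_eq_zero_iff hm] at h0
  have h1 : ∀ᵐ ξ ∂P, False := by
    filter_upwards [h0] with ξ hξ using limitDensity_completeVec_ne_zero w ξ hξ
  rw [eventually_false_iff_eq_bot, ae_eq_bot] at h1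
  exact hP h1

/-- One factor `8` for each of the `m + 1` kernel factors that are not constant. This gives one
integrable majorant for the whole null hypothesis. -/
lemma limitDensity_completeVec_le {m : ℕ} {w : Fin m → ℝ} (hw : ∀ i, 0 ≤ w i) {ξ : ℝ}
    (hξ : 0 ≤ ξ) (hξ2 : ξ ≤ 2) :
    limitDensity (completeVec (m + 2) w) ξ ≤
      8 ^ (m + 1) * limitDensity (completeVec (m + 2) w) 2 := by
  rw [limitDensity_completeVec, limitDensity_completeVec, mul_left_comm]
  gcongr
  rw [← lintegral_const_mul' _ _ (by simp)]
  refine setLIntegral_mono' measurableSet_Ioi fun s hs => ?_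
  have hs0 : 0 < s := hs
  have h8 : (8 : ℝ≥0∞) ^ (m + 1) = ENNReal.ofReal (8 ^ (m + 1)) := by
    rw [ENNReal.ofReal_pow (by norm_num)]
    norm_num
  rw [h8, ← ENNReal.ofReal_mul (by positivity)]
  refine ENNReal.ofReal_le_ofReal ?_
  have h1 : ∏ i, tailDensity ξ (w i * s) ≤ ∏ i, 8 * tailDensity 2 (w i * s) :=
    Finset.prod_le_prod (fun i _ => (tailDensity_pos _ _).le)
      fun i _ => tailDensity_le hξ hξ2 (mul_nonneg (hw i) hs0.le)
  have h2 := tailDensity_le hξ hξ2 hs0.le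
  have h3 : 0 ≤ ∏ i, tailDensity ξ (w i * s) :=
    Finset.prod_nonneg fun i _ => (tailDensity_pos _ _).le
  have h4 := (tailDensity_pos 2 s).le
  calc s ^ m * (tailDensity ξ s * ∏ i, tailDensity ξ (w i * s))
      ≤ s ^ m * ((8 * tailDensity 2 s) * ∏ i, 8 * tailDensity 2 (w i * s)) := by gcongr
    _ = 8 ^ (m + 1) * (s ^ m * (tailDensity 2 s * ∏ i, tailDensity 2 (w i * s))) := by
        rw [Finset.prod_mul_distrib, Finset.prod_const, Finset.card_univ, Fintype.card_fin]
        ring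

lemma mixtureDensity_ne_top {m : ℕ} {P : Measure ℝ} [IsFiniteMeasure P]
    (hP : ∀ᵐ ξ ∂P, ξ ∈ Icc (0 : ℝ) 2) {w : Fin m → ℝ} (hw : ∀ i, 0 < w i) :
    mixtureDensity m P w ≠ ∞ := by
  rw [mixtureDensity_eq_ofReal hP hw]
  exact ENNReal.ofReal_ne_top

/-- Any weight on `[0, 1 - ε]`, scaled up far enough, controls the limiting level. -/
theorem exists_hasLimitLevel (m : ℕ) {ε : ℝ} (hε₀ : 0 < ε) (hε₁ : ε < 1) {α : ℝ} (hα : 0 < α)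
    (W : Measure ℝ) [IsFiniteMeasure W] (Λ₀ : Measure ℝ) [IsFiniteMeasure Λ₀]
    (hΛ₀ : Λ₀ (Icc 0 (1 - ε)) ≠ 0) :
    ∃ c₀ : ℝ≥0, ∀ c : ℝ≥0, c₀ ≤ c → HasLimitLevel (m + 2) ε W (c • Λ₀) α := by
  classical
  set N := mixtureDensity m (W.restrict (Ioc (1 - ε) 2)) with hN
  set M := mixtureDensity m (Λ₀.restrict (Icc 0 (1 - ε))) with hM
  have hNm : Measurable N := measurable_mixtureDensity _ _
  have hMm : Measurable M := measurable_mixtureDensity _ _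
  have hDm : Measurable fun w : Fin m → ℝ => limitDensity (completeVec (m + 2) w) 2 :=
    (measurable_limitDensity_completeVec m).comp (f := fun w : Fin m → ℝ => (w, (2 : ℝ)))
      (by fun_prop)
  -- For `c ≥ n` the rejection region of `c • Λ₀` lies in `S n`. The sets decrease, and each
  -- positive `w` eventually leaves them because `M w > 0` and `N w < ∞`.
  set S : ℕ → Set (Fin m → ℝ) := fun n => {w | n * M w < N w} with hS
  have hSm : ∀ n, MeasurableSet (S n) := fun n => measurableSet_lt (hMm.const_mul _) hNm
  set U : (Fin m → ℝ) → ℝ≥0∞ := fun w => 8 ^ (m + 1) * limitDensity (completeVec (m + 2) w) 2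
    with hU
  have hUm : Measurable U := hDm.const_mul _
  have hlim : Tendsto (fun n => ∫⁻ w in reverseSimplex m 1, (S n).indicator U w) atTop (𝓝 0) := by
    rw [show (0 : ℝ≥0∞) = ∫⁻ _w in reverseSimplex m 1, 0 by simp]
    refine tendsto_lintegral_of_dominated_convergence U (fun n => hUm.indicator (hSm n))
      (fun n => Eventually.of_forall fun w => indicator_le_self _ _ w) ?_ ?_
    · rw [hU, lintegral_const_mul _ hDm, lintegral_reverseSimplex_limitDensity m (by norm_num)]
      simp
    · filter_upwards [ae_restrict_mem (measurableSet_reverseSimplex m 1)] with w hw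
      have hNw : N w ≠ ∞ := mixtureDensity_ne_top (ae_restrict_Ioc_mem hε₁) fun i => (hw.2 i).1
      have hMw : M w ≠ 0 := mixtureDensity_ne_zero (by rwa [Ne, Measure.restrict_eq_zero]) w
      obtain ⟨n₀, hn₀⟩ := ENNReal.exists_nat_mul_gt hMw hNw
      refine tendsto_const_nhds.congr' ?_
      filter_upwards [eventually_ge_atTop n₀] with n hn
      refine (indicator_of_notMem ?_ _).symm
      simp only [hS, mem_ofPred_eq, not_lt]
      exact hn₀.le.trans (by gcongr)
  obtain ⟨n, hn⟩ := (hlim.eventually_le_const (ENNReal.ofReal_pos.2 hα)).exists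
  refine ⟨n, fun c hc => iSup₂_le fun ξ hξ => ?_⟩
  rw [limitExpectation_eq]
  refine (setLIntegral_mono' (measurableSet_reverseSimplex m 1) fun w hw => ?_).trans hn
  rw [test_completeVec]
  have hscale : mixtureDensity m ((c • Λ₀).restrict (Icc 0 (1 - ε))) w = c * M w := by
    unfold mixtureDensity at hM
    rw [hM, Measure.restrict_smul, mixtureDensity, lintegral_smul_measure]
    rfl
  rw [hscale]
  split_ifs with hlt
  · have hmem : w ∈ S n := by
      refine lt_of_le_of_lt ?_ hlt
      gcongr
      exact_mod_cast hc
    rw [indicator_of_mem hmem, one_mul]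
    exact limitDensity_completeVec_le (fun i => (hw.2 i).1.le) hξ.1 (by linarith [hξ.2])
  · simp

/-! ### Order statistics -/

/-- Passing to exceedance counts removes the sorting permutation. The bound `j < n` keeps the
default value `0` of `orderStat` out. -/
lemma lt_orderStat_iff {n : ℕ} (x : Fin n → ℝ) {j : ℕ} (hj : j < n) (t : ℝ) :
    t < orderStat x j ↔ j < (Finset.univ.filter fun i => t < x i).card := by
  set σ := Tuple.sort (fun i => -x i) with hσ
  have hanti : ∀ i i', i ≤ i' → x (σ i') ≤ x (σ i) := fun i i' h => by
    simpa using Tuple.monotone_sort (fun i => -x i) h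
  have hcard : (Finset.univ.filter fun i => t < x i).card =
      (Finset.univ.filter fun i => t < x (σ i)).card := by
    have : (Finset.univ.filter fun i => t < x i) =
        (Finset.univ.filter fun i => t < x (σ i)).map σ.toEmbedding := by
      ext i
      simp only [Finset.mem_filter, Finset.mem_univ, true_and, Finset.mem_map_equiv,
        Equiv.apply_symm_apply]
    rw [this, Finset.card_map]
  have hval : orderStat x j = x (σ ⟨j, hj⟩) := by rw [orderStat, dif_pos hj]
  rw [hval, hcard]
  constructor
  · intro h
    have hsub : Finset.Iic ⟨j, hj⟩ ⊆ Finset.univ.filter fun i => t < x (σ i) := fun i hi => by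
      simpa using h.trans_le (hanti _ _ (Finset.mem_Iic.1 hi))
    have := Finset.card_le_card hsub
    rw [Fin.card_Iic] at this
    exact this
  · intro h
    by_contra hcon
    have hsub : (Finset.univ.filter fun i => t < x (σ i)) ⊆ Finset.Iio ⟨j, hj⟩ := fun i hi => by
      rw [Finset.mem_Iio]
      by_contra hij
      have h1 : t < x (σ i) := by simpa using hi
      exact hcon (h1.trans_le (hanti _ _ (not_lt.1 hij)))
    have := Finset.card_le_card hsub
    rw [Fin.card_Iio] at this
    exact absurd h (not_lt.2 this)

lemma orderStat_eq {n k : ℕ} (x : Fin n → ℝ) (σ : Fin k ↪ Fin n) (hσ : StrictAnti (x ∘ σ))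
    (hlt : ∀ i, i ∉ range σ → ∀ j, x i < x (σ j)) (j : Fin k) : orderStat x j = x (σ j) := by
  have hkn : k ≤ n := by simpa using Fintype.card_le_of_injective σ σ.injective
  refine eq_of_forall_lt_iff fun t => ?_
  rw [lt_orderStat_iff x (j.2.trans_le hkn)]
  constructor
  · intro h
    by_contra hcon
    have hsub : (Finset.univ.filter fun i => t < x i) ⊆ (Finset.Iio j).map σ := fun i hi => by
      have h1 : t < x i := by simpa using hi
      have h2 : i ∈ range σ := by
        by_contra h3
        exact hcon (h1.trans (hlt i h3 j))
      obtain ⟨j', rfl⟩ := h2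
      refine Finset.mem_map_of_mem _ (Finset.mem_Iio.2 ?_)
      by_contra h3
      exact hcon (h1.trans_le (hσ.antitone (not_lt.1 h3)))
    have := Finset.card_le_card hsub
    rw [Finset.card_map, Fin.card_Iio] at this
    exact absurd h (not_lt.2 this)
  · intro h
    have hsub : (Finset.Iic j).map σ ⊆ Finset.univ.filter fun i => t < x i := fun i hi => by
      obtain ⟨j', hj', rfl⟩ := Finset.mem_map.1 hi
      simpa using h.trans_le (hσ.antitone (Finset.mem_Iic.1 hj'))
    have := Finset.card_le_card hsub
    rw [Finset.card_map, Fin.card_Iic] at this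
    exact this

lemma measurable_orderStat (n j : ℕ) : Measurable fun x : Fin n → ℝ => orderStat x j := by
  by_cases hj : j < n
  · refine measurable_of_Ioi fun t => ?_
    have : (fun x : Fin n → ℝ => orderStat x j) ⁻¹' Ioi t =
        {x | j < ∑ i, if t < x i then 1 else 0} := by
      ext x
      rw [mem_preimage, mem_Ioi, lt_orderStat_iff x hj, Finset.card_filter]
      rfl
    rw [this]
    refine measurableSet_lt measurable_const (Finset.measurable_sum _ fun i _ => ?_)
    exact Measurable.ite (measurableSet_lt measurable_const (measurable_pi_apply i))
      measurable_const measurable_const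
  · simp only [orderStat, hj, dif_neg, not_false_eq_true]
    exact measurable_const

lemma orderStat_le_add {n j : ℕ} (hj : j < n) {x y : Fin n → ℝ} {δ : ℝ}
    (h : ∀ i, x i ≤ y i + δ) : orderStat x j ≤ orderStat y j + δ := by
  refine le_of_forall_lt fun t ht => ?_
  have h1 : t - δ < orderStat y j := by
    rw [lt_orderStat_iff _ hj] at ht ⊢
    refine ht.trans_le (Finset.card_le_card fun i hi => ?_)
    simp only [Finset.mem_filter, Finset.mem_univ, true_and] at hi ⊢
    linarith [h i]
  linarith

/-- Shifting all values by `δ` shifts the exceedance counts accordingly, so each order statistic is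
1-Lipschitz in the sup norm. -/
lemma abs_orderStat_sub_le {n j : ℕ} (hj : j < n) {x y : Fin n → ℝ} {δ : ℝ}
    (h : ∀ i, |y i - x i| ≤ δ) : |orderStat y j - orderStat x j| ≤ δ := by
  have h1 := orderStat_le_add hj (x := x) (y := y) (δ := δ) fun i => by
    linarith [(abs_le.1 (h i)).1]
  have h2 := orderStat_le_add hj (x := y) (y := x) (δ := δ) fun i => by
    linarith [(abs_le.1 (h i)).2]
  exact abs_le.2 ⟨by linarith, by linarith⟩

/-- The vector of the `k` largest values. -/
def topValues {n : ℕ} (k : ℕ) (x : Fin n → ℝ) : Fin k → ℝ := fun j => orderStat x j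

lemma measurable_topValues (n k : ℕ) : Measurable (topValues k : (Fin n → ℝ) → Fin k → ℝ) :=
  measurable_pi_iff.2 fun j => measurable_orderStat n j

/-- Selecting the coordinates in the range of an embedding and the remaining ones. -/
lemma measurePreserving_embedding_prod {n k : ℕ} (ν : Measure ℝ) [IsProbabilityMeasure ν]
    (σ : Fin k ↪ Fin n) :
    MeasurePreserving (fun x : Fin n → ℝ => ((fun j => x (σ j) : Fin k → ℝ),
      (fun i => x i : {i // i ∉ range σ} → ℝ))) (Measure.pi fun _ => ν)
      ((Measure.pi fun _ => ν).prod (Measure.pi fun _ => ν)) := by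
  classical
  set e : Fin k ⊕ {i // i ∉ range σ} ≃ Fin n :=
    (Equiv.sumCongr (Equiv.ofInjective σ σ.injective) (Equiv.refl _)).trans
      (Equiv.sumCompl (· ∈ range σ)) with he
  have h1 := (measurePreserving_piCongrLeft (fun _ : Fin n => ν) e).symm
  have h2 := measurePreserving_sumPiEquivProdPi
    (fun _ : Fin k ⊕ {i // i ∉ range σ} => ν)
  exact h2.comp h1

/-- Given the selected coordinates, the other `n - (d + 1)` are independent of them and must all lie
strictly below the last selected value. -/
lemma pi_topEvent {n d : ℕ} (ν : Measure ℝ) [IsProbabilityMeasure ν] (σ : Fin (d + 1) ↪ Fin n)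
    {G : Set (Fin (d + 1) → ℝ)} (hG : MeasurableSet G) :
    Measure.pi (fun _ : Fin n => ν) {x | (fun j => x (σ j)) ∈ G ∧
        ∀ i, i ∉ range σ → x i < x (σ (Fin.last d))} =
      ∫⁻ z in G, ν (Iio (z (Fin.last d))) ^ (n - (d + 1)) ∂Measure.pi fun _ => ν := by
  classical
  have hmp := measurePreserving_embedding_prod ν σ
  set S : Set ((Fin (d + 1) → ℝ) × ({i // i ∉ range σ} → ℝ)) :=
    {p | p.1 ∈ G ∧ ∀ i, p.2 i < p.1 (Fin.last d)} with hS
  have hSm : MeasurableSet S := by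
    have h2 : MeasurableSet {p : (Fin (d + 1) → ℝ) × ({i // i ∉ range σ} → ℝ) |
        ∀ i, p.2 i < p.1 (Fin.last d)} := by
      rw [ofPred_forall]
      exact MeasurableSet.iInter fun i => measurableSet_lt
        ((measurable_pi_apply i).comp measurable_snd) ((measurable_pi_apply _).comp measurable_fst)
    exact (measurable_fst hG).inter h2
  have hpre : {x : Fin n → ℝ | (fun j => x (σ j)) ∈ G ∧
      ∀ i, i ∉ range σ → x i < x (σ (Fin.last d))} =
      (fun x : Fin n → ℝ => ((fun j => x (σ j) : Fin (d + 1) → ℝ),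
      (fun i => x i : {i // i ∉ range σ} → ℝ))) ⁻¹' S := by
    ext x
    simp [hS]
  rw [hpre, hmp.measure_preimage hSm.nullMeasurableSet, Measure.prod_apply hSm,
    ← lintegral_indicator hG]
  refine lintegral_congr fun z => ?_
  by_cases hz : z ∈ G
  · rw [indicator_of_mem hz]
    have : Prod.mk z ⁻¹' S = univ.pi fun _ => Iio (z (Fin.last d)) := by
      ext w
      simp [hS, hz]
    rw [this, Measure.pi_pi, Finset.prod_const, Finset.card_univ]
    congr 1
    rw [Fintype.card_subtype_compl, Fintype.card_fin]
    congr 1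
    have := Fintype.card_congr (Equiv.ofInjective σ σ.injective)
    rw [Fintype.card_fin] at this
    exact this.symm
  · rw [indicator_of_notMem hz]
    have : Prod.mk z ⁻¹' S = ∅ := by
      ext w
      simp [hS, hz]
    rw [this, measure_empty]

/-- The joint law of the largest values of an i.i.d. sample, away from ties. -/
theorem descFactorial_mul_lintegral_le {n d : ℕ} (ν : Measure ℝ) [IsProbabilityMeasure ν]
    {G : Set (Fin (d + 1) → ℝ)} (hG : MeasurableSet G) :
    (n.descFactorial (d + 1) : ℝ≥0∞) * ∫⁻ z in G ∩ {z | StrictAnti z},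
        ν (Iio (z (Fin.last d))) ^ (n - (d + 1)) ∂(Measure.pi fun _ => ν) ≤
      Measure.pi (fun _ : Fin n => ν) {x | topValues (d + 1) x ∈ G} := by
  set H := G ∩ {z | StrictAnti z} with hH
  have hHm : MeasurableSet H := hG.inter (measurableSet_strictAnti _)
  set E : (Fin (d + 1) ↪ Fin n) → Set (Fin n → ℝ) := fun σ => {x | (fun j => x (σ j)) ∈ H ∧
        ∀ i, i ∉ range σ → x i < x (σ (Fin.last d))} with hE
  have hlt : ∀ σ, ∀ x ∈ E σ, ∀ i, i ∉ range σ → ∀ j, x i < x (σ j) := fun σ x hx i hi j =>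
    (hx.2 i hi).trans_le (hx.1.2.antitone (Fin.le_last j))
  have htop : ∀ σ, ∀ x ∈ E σ, ∀ j : Fin (d + 1), orderStat x j = x (σ j) := fun σ x hx j =>
    orderStat_eq x σ hx.1.2 (hlt σ x hx) j
  have hEm : ∀ σ, MeasurableSet (E σ) := fun σ => by
    have h1 : Measurable fun (x : Fin n → ℝ) (j : Fin (d + 1)) => x (σ j) :=
      measurable_pi_iff.2 fun j => measurable_pi_apply (σ j)
    have h2 : MeasurableSet {x : Fin n → ℝ | ∀ i, i ∉ range σ → x i < x (σ (Fin.last d))} := by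
      simp only [ofPred_forall]
      exact MeasurableSet.iInter fun i => MeasurableSet.iInter fun _ => measurableSet_lt
        (measurable_pi_apply _) (measurable_pi_apply _)
    exact (h1 hHm).inter h2
  -- Strict decrease and strict dominance over the rest let the sample determine which index holds
  -- each of the top values.
  have hdisj : Pairwise (Function.onFun Disjoint E) := by
    intro σ τ hne
    refine disjoint_left.2 fun x hxσ hxτ => hne ?_
    ext j : 1
    have heq : ∀ j, x (σ j) = x (τ j) := fun j => by rw [← htop σ x hxσ, ← htop τ x hxτ]
    by_cases hr : σ j ∈ range τ
    · obtain ⟨j', hj'⟩ := hr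
      have h1 : x (τ j') = x (τ j) := by rw [hj', heq]
      rw [← hj', hxτ.1.2.injective h1]
    · have := hlt τ x hxτ _ hr j
      rw [heq] at this
      exact absurd this (lt_irrefl _)
  -- Samples with relevant ties belong to no `E σ`, hence an inclusion and only an inequality of
  -- measures.
  have hsub : ⋃ σ, E σ ⊆ {x | topValues (d + 1) x ∈ G} := by
    refine iUnion_subset fun σ x hx => ?_
    have : topValues (d + 1) x = fun j => x (σ j) := funext fun j => htop σ x hx j
    rw [mem_ofPred_eq, this]
    exact hx.1.1
  refine le_trans (le_of_eq ?_) (measure_mono hsub)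
  rw [measure_iUnion hdisj hEm, tsum_fintype]
  simp only [hE, pi_topEvent ν _ hHm]
  rw [Finset.sum_const, Finset.card_univ, Fintype.card_embedding_eq, Fintype.card_fin,
    Fintype.card_fin, nsmul_eq_mul]

/-! ### Quantile coupling -/

open Classical in
/-- The quantile of `ν` at level `1 - p`, for `p ∈ (0, 1)`. -/
def upperQuantile (ν : Measure ℝ) (p : ℝ) : ℝ :=
  if p ∈ Ioo (0 : ℝ) 1 then sInf {x | 1 - p ≤ cdf ν x} else 0

/-- The Galois connection between quantiles and distribution function; right continuity shows that
the infimum is attained. -/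
lemma upperQuantile_le_iff (ν : Measure ℝ) {p : ℝ} (hp : p ∈ Ioo (0 : ℝ) 1) (x : ℝ) :
    upperQuantile ν p ≤ x ↔ 1 - p ≤ cdf ν x := by
  rw [upperQuantile, if_pos hp]
  set S := {x | 1 - p ≤ cdf ν x} with hS
  have hne : S.Nonempty :=
    ((tendsto_cdf_atTop ν).eventually_const_le (show 1 - p < 1 by linarith [hp.1])).exists
  have hbdd : BddBelow S := by
    obtain ⟨y, hy⟩ :=
      ((tendsto_cdf_atBot ν).eventually_lt_const (show 0 < 1 - p by linarith [hp.2])).exists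
    refine ⟨y, fun z hz => ?_⟩
    by_contra hcon
    have h1 : 1 - p ≤ cdf ν z := hz
    linarith [monotone_cdf ν (not_le.1 hcon).le]
  refine ⟨fun h => ?_, fun h => csInf_le hbdd h⟩
  have h1 : Tendsto (cdf ν) (𝓝[>] (sInf S)) (𝓝 (cdf ν (sInf S))) :=
    ((cdf ν).right_continuous (sInf S)).tendsto.mono_left (nhdsWithin_mono _ Ioi_subset_Ici_self)
  have h2 : 1 - p ≤ cdf ν (sInf S) := by
    refine ge_of_tendsto h1 ?_
    filter_upwards [self_mem_nhdsWithin] with y hy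
    obtain ⟨z, hz, hzy⟩ := exists_lt_of_csInf_lt hne hy
    exact le_trans hz (monotone_cdf ν hzy.le)
  exact h2.trans (monotone_cdf ν h)

lemma measurable_upperQuantile (ν : Measure ℝ) : Measurable (upperQuantile ν) := by
  refine measurable_of_Iic fun x => ?_
  have : upperQuantile ν ⁻¹' Iic x =
      (Ioo 0 1 ∩ {p | 1 - p ≤ cdf ν x}) ∪ ((Ioo 0 1)ᶜ ∩ {_p | 0 ≤ x}) := by
    ext p
    by_cases hp : p ∈ Ioo (0 : ℝ) 1
    · simp [upperQuantile_le_iff ν hp x, hp.1, hp.2]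
    · have h0 : upperQuantile ν p = 0 := if_neg hp
      simp only [mem_preimage, mem_Iic, h0, mem_union, mem_inter_iff, hp, false_and, mem_compl_iff,
        not_false_eq_true, true_and, false_or, mem_ofPred_eq]
  rw [this]
  exact (measurableSet_Ioo.inter (measurableSet_le (by fun_prop) measurable_const)).union
    (measurableSet_Ioo.compl.inter (MeasurableSet.const _))

/-- A law on the real line is the image of the uniform law under its quantile function. -/
lemma map_upperQuantile (ν : Measure ℝ) [IsProbabilityMeasure ν] :
    (volume.restrict (Ioo 0 1)).map (upperQuantile ν) = ν := by
  refine Measure.ext_of_Iic _ _ fun x => ?_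
  have h0 := cdf_nonneg ν x
  have h1 := cdf_le_one ν x
  rw [Measure.map_apply (measurable_upperQuantile ν) measurableSet_Iic,
    Measure.restrict_apply (measurable_upperQuantile ν measurableSet_Iic), ← ofReal_cdf]
  refine le_antisymm ?_ ?_
  · have hsub : upperQuantile ν ⁻¹' Iic x ∩ Ioo 0 1 ⊆ Ico (1 - cdf ν x) 1 := fun p hp =>
      ⟨by linarith [(upperQuantile_le_iff ν hp.2 x).1 hp.1], hp.2.2⟩
    refine (measure_mono hsub).trans ?_
    rw [Real.volume_Ico, sub_sub_cancel]
  · have hsub : Ioo (1 - cdf ν x) 1 ⊆ upperQuantile ν ⁻¹' Iic x ∩ Ioo 0 1 := fun p hp => by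
      have hp' : p ∈ Ioo (0 : ℝ) 1 := ⟨by linarith [hp.1], hp.2⟩
      exact ⟨(upperQuantile_le_iff ν hp' x).2 (by linarith [hp.1]), hp'⟩
    refine le_trans ?_ (measure_mono hsub)
    rw [Real.volume_Ioo, sub_sub_cancel]

/-- The scale `s / n` is the one on which the upper tail levels of the largest values live. The
factor `n ^ (-d)` cancels the falling factorial that counts the choices of top indices. -/
lemma lintegral_pi_eq_upperQuantile {d : ℕ} (ν : Measure ℝ) [IsProbabilityMeasure ν]
    {H : (Fin d → ℝ) → ℝ≥0∞} (hH : Measurable H) {n : ℕ} (hn : 0 < n) :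
    ∫⁻ z, H z ∂(Measure.pi fun _ => ν) = ENNReal.ofReal ((1 / (n : ℝ)) ^ d) *
      ∫⁻ s in {s : Fin d → ℝ | ∀ i, 0 < s i ∧ s i < n},
        H fun i => upperQuantile ν (1 / (n : ℝ) * s i) := by
  have hQ : Measurable fun (p : Fin d → ℝ) i => upperQuantile ν (p i) :=
    measurable_pi_iff.2 fun i => (measurable_upperQuantile ν).comp (measurable_pi_apply i)
  have hmap : (Measure.pi fun _ : Fin d => ν) =
      (volume.restrict {p : Fin d → ℝ | ∀ i, 0 < p i ∧ p i < 1}).map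
        fun p i => upperQuantile ν (p i) := by
    have h1 : {p : Fin d → ℝ | ∀ i, 0 < p i ∧ p i < 1} = univ.pi fun _ => Ioo 0 1 := by
      ext p; simp
    rw [h1, volume_pi, Measure.restrict_pi_pi, Measure.pi_map_pi
      (fun i => (measurable_upperQuantile ν).aemeasurable)]
    simp_rw [map_upperQuantile]
  have hnpos : (0 : ℝ) < n := by exact_mod_cast hn
  have hHQ : Measurable fun p : Fin d → ℝ => H fun i => upperQuantile ν (p i) := hH.comp hQ
  rw [hmap, lintegral_map hH hQ, ← lintegral_indicator (measurableSet_forall_mem_Ioo _ _),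
    lintegral_eq_mul_lintegral_smul
      (hHQ.indicator (measurableSet_forall_mem_Ioo _ _)) (one_div_pos.2 hnpos),
    ← lintegral_indicator (measurableSet_forall_mem_Ioo _ _)]
  congr 1
  refine lintegral_congr fun s => ?_
  have hiff : (1 / (n : ℝ)) • s ∈ {p : Fin d → ℝ | ∀ i, 0 < p i ∧ p i < 1} ↔
      s ∈ {s : Fin d → ℝ | ∀ i, 0 < s i ∧ s i < n} := by
    simp only [mem_ofPred_eq, Pi.smul_apply, smul_eq_mul]
    refine forall_congr' fun i => and_congr (mul_pos_iff_of_pos_left (one_div_pos.2 hnpos)) ?_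
    rw [one_div, inv_mul_eq_div, div_lt_one hnpos]
  by_cases hs : s ∈ {s : Fin d → ℝ | ∀ i, 0 < s i ∧ s i < n}
  · rw [indicator_of_mem hs, indicator_of_mem (hiff.2 hs)]
    rfl
  · rw [indicator_of_notMem hs, indicator_of_notMem fun h => hs (hiff.1 h)]

/-! ### Convergence of the largest order statistics -/

lemma tendsto_one_sub_div_pow (s : ℝ) :
    Tendsto (fun n : ℕ => (1 - 1 / (n : ℝ) * s) ^ n) atTop (𝓝 (Real.exp (-s))) := by
  refine (Real.tendsto_one_add_div_pow_exp (-s)).congr fun n => ?_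
  congr 1
  ring

/-- Compare `F(a n w + b n) ^ n → G_ξ(w)` with `(1 - s/n) ^ n → exp (-s)`: the order of the limits
decides on which side of the quantile `a n w + b n` lies. -/
lemma tendsto_upperQuantile {ν : Measure ℝ} {ξ : ℝ} (hξ : 0 ≤ ξ) {a b : ℕ → ℝ}
    (hab : IsNorming ν ξ a b) {s : ℝ} (hs : 0 < s) :
    Tendsto (fun n : ℕ => (upperQuantile ν (1 / (n : ℝ) * s) - b n) / a n) atTop
      (𝓝 (tailInv ξ s)) := by
  have hp : ∀ᶠ n : ℕ in atTop, 1 / (n : ℝ) * s ∈ Ioo (0 : ℝ) 1 := by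
    filter_upwards [tendsto_natCast_atTop_atTop.eventually_gt_atTop s, eventually_gt_atTop 0]
      with n hn hn0
    have hnpos : (0 : ℝ) < n := by exact_mod_cast hn0
    refine ⟨by positivity, ?_⟩
    rwa [one_div, inv_mul_eq_div, div_lt_one hnpos]
  have hexp := tendsto_one_sub_div_pow s
  refine tendsto_order.2 ⟨fun w hw => ?_, fun w hw => ?_⟩
  · filter_upwards [hp, (hab.2 w).eventually_lt hexp (gev_lt_exp_neg hξ hs hw)] with n hn hlt
    rw [lt_div_iff₀ (hab.1 n), lt_sub_iff_add_lt, mul_comm]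
    by_contra hcon
    rw [not_lt, upperQuantile_le_iff ν hn] at hcon
    exact absurd hlt (not_lt.2 (pow_le_pow_left₀ (by linarith [hn.2]) hcon n))
  -- The quantile equivalence yields only `≤`; the intermediate point restores strict inequality.
  · obtain ⟨w', hw', hww'⟩ := exists_between hw
    filter_upwards [hp, hexp.eventually_lt (hab.2 w') (exp_neg_lt_gev hξ hs hw')] with n hn hlt
    have h1 : 1 - 1 / (n : ℝ) * s ≤ cdf ν (a n * w' + b n) := by
      by_contra hcon
      exact absurd hlt (not_lt.2 (pow_le_pow_left₀ (cdf_nonneg _ _) (not_le.1 hcon).le n))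
    rw [← upperQuantile_le_iff ν hn] at h1
    rw [div_lt_iff₀ (hab.1 n)]
    nlinarith [hab.1 n]

lemma tendsto_descFactorial_mul (d : ℕ) :
    Tendsto (fun n : ℕ => (n.descFactorial d : ℝ) * (1 / (n : ℝ)) ^ d) atTop (𝓝 1) := by
  induction d with
  | zero => simp
  | succ d ih =>
    have h1 : Tendsto (fun n : ℕ => ((n - d : ℕ) : ℝ) * (1 / (n : ℝ))) atTop (𝓝 1) := by
      have h2 : Tendsto (fun n : ℕ => 1 - (d : ℝ) * (1 / (n : ℝ))) atTop (𝓝 (1 - d * 0)) :=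
        tendsto_const_nhds.sub (tendsto_one_div_atTop_nhds_zero_nat.const_mul _)
      rw [mul_zero, sub_zero] at h2
      refine h2.congr' ?_
      filter_upwards [eventually_gt_atTop d] with n hn
      have : (n : ℝ) ≠ 0 := by
        have : 0 < n := by omega
        positivity
      rw [Nat.cast_sub hn.le]
      field_simp
    have := h1.mul ih
    rw [mul_one] at this
    refine this.congr fun n => ?_
    rw [Nat.descFactorial_succ, pow_succ]
    push_cast
    ring

/-- The lower bound for the asymptotic law of the normalized largest order statistics. -/
theorem le_liminf_topValues {d : ℕ} (ν : Measure ℝ) [IsProbabilityMeasure ν] {ξ : ℝ} (hξ : 0 ≤ ξ)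
    {a b : ℕ → ℝ} (hab : IsNorming ν ξ a b) {O : Set (Fin (d + 1) → ℝ)} (hO : IsOpen O) :
    ∫⁻ s in openChamber (d + 1), O.indicator 1 (fun i => tailInv ξ (s i)) *
        ENNReal.ofReal (Real.exp (-s (Fin.last d))) ≤
      liminf (fun n : ℕ => Measure.pi (fun _ : Fin n => ν)
        {x | (fun j => (topValues (d + 1) x j - b n) / a n) ∈ O}) atTop := by
  set z : ℕ → (Fin (d + 1) → ℝ) → Fin (d + 1) → ℝ := fun n s i =>
    upperQuantile ν (1 / (n : ℝ) * s i) with hz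
  have hzm : ∀ n, Measurable (z n) := fun n => measurable_pi_iff.2 fun i =>
    (measurable_upperQuantile ν).comp ((measurable_pi_apply i).const_mul _)
  set G : ℕ → Set (Fin (d + 1) → ℝ) := fun n => {x | (fun j => (x j - b n) / a n) ∈ O} with hG
  have hGm : ∀ n, MeasurableSet (G n) := fun n => by
    have : Measurable fun (x : Fin (d + 1) → ℝ) j => (x j - b n) / a n := by fun_prop
    exact this hO.measurableSet
  set g : ℕ → (Fin (d + 1) → ℝ) → ℝ≥0∞ := fun n x =>
    ν (Iio (x (Fin.last d))) ^ (n - (d + 1)) with hg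
  have hgm : ∀ n, Measurable (g n) := fun n => by
    have h1 : Monotone fun x : ℝ => ν (Iio x) := fun x y hxy => measure_mono (Iio_subset_Iio hxy)
    exact (h1.measurable.comp (measurable_pi_apply _)).pow_const _
  have hGA : ∀ n, MeasurableSet (G n ∩ {z | StrictAnti z}) := fun n =>
    (hGm n).inter (measurableSet_strictAnti _)
  set c : ℕ → ℝ≥0∞ := fun n =>
    ENNReal.ofReal ((n.descFactorial (d + 1) : ℝ) * (1 / (n : ℝ)) ^ (d + 1)) with hc
  set B : ℕ → Set (Fin (d + 1) → ℝ) := fun n => {s | ∀ i, 0 < s i ∧ s i < n} with hB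
  set Φ : ℕ → (Fin (d + 1) → ℝ) → ℝ≥0∞ := fun n =>
    (B n).indicator fun s => c n * (G n ∩ {z | StrictAnti z}).indicator (g n) (z n s) with hΦ
  have hΦm : ∀ n, Measurable (Φ n) := fun n =>
    ((((hgm n).indicator (hGA n)).comp (hzm n)).const_mul _).indicator
      (measurableSet_forall_mem_Ioo _ _)
  have hle : ∀ᶠ n : ℕ in atTop, ∫⁻ s, Φ n s ≤ Measure.pi (fun _ : Fin n => ν)
      {x | topValues (d + 1) x ∈ G n} := by
    filter_upwards [eventually_gt_atTop 0] with n hn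
    refine le_trans (le_of_eq ?_) (descFactorial_mul_lintegral_le ν (hGm n))
    have hgz : Measurable fun s => (G n ∩ {z | StrictAnti z}).indicator (g n) (z n s) :=
      ((hgm n).indicator (hGA n)).comp (hzm n)
    rw [← lintegral_indicator (hGA n), lintegral_pi_eq_upperQuantile ν ((hgm n).indicator (hGA n)) hn,
      lintegral_indicator (measurableSet_forall_mem_Ioo _ _), lintegral_const_mul _ hgz,
      ← mul_assoc]
    congr 1
    rw [hc]
    dsimp only
    rw [ENNReal.ofReal_mul (by positivity), ENNReal.ofReal_natCast]
  refine le_trans ?_ (liminf_le_liminf hle)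
  -- Fatou's lemma; no majorant is available or needed for a lower bound.
  refine le_trans ?_ (lintegral_liminf_le hΦm)
  rw [← lintegral_indicator (measurableSet_openChamber _)]
  refine lintegral_mono fun s => ?_
  by_cases hs : s ∈ openChamber (d + 1)
  swap
  · rw [indicator_of_notMem hs]; exact zero_le
  rw [indicator_of_mem hs]
  by_cases hsO : (fun i => tailInv ξ (s i)) ∈ O
  swap
  · rw [indicator_of_notMem hsO, zero_mul]; exact zero_le
  rw [indicator_of_mem hsO, Pi.one_apply, one_mul]
  have hnorm : ∀ i, Tendsto (fun n => (z n s i - b n) / a n) atTop (𝓝 (tailInv ξ (s i))) :=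
    fun i => tendsto_upperQuantile hξ hab (hs.2 i)
  have hmemB : ∀ᶠ n in atTop, s ∈ B n := by
    refine eventually_all.2 fun i => ?_
    filter_upwards [tendsto_natCast_atTop_atTop.eventually_gt_atTop (s i)] with n hn
    exact ⟨hs.2 i, hn⟩
  have hmemG : ∀ᶠ n in atTop, z n s ∈ G n :=
    (tendsto_pi_nhds.2 hnorm).eventually_mem (hO.mem_nhds hsO)
  have hmemA : ∀ᶠ n in atTop, StrictAnti (z n s) := by
    have : ∀ᶠ n in atTop, ∀ i j, i < j → z n s j < z n s i := by
      refine eventually_all.2 fun i => eventually_all.2 fun j => ?_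
      by_cases hij : i < j
      · filter_upwards [(hnorm j).eventually_lt (hnorm i)
          (tailInv_lt_tailInv hξ (hs.2 i) (hs.1 hij))] with n hn _
        have := (div_lt_div_iff_of_pos_right (hab.1 n)).1 hn
        linarith
      · exact Eventually.of_forall fun n h => absurd h hij
    filter_upwards [this] with n hn i j hij using hn i j hij
  -- The mass strictly below the quantile is bounded below by `F(a n w + b n)` with `w` slightly
  -- smaller, which handles atoms. Raising the exponent from `n - (d + 1)` to `n` only decreases a
  -- number in `[0, 1]`. Afterwards `w` increases to `tailInv ξ (s (Fin.last d))`.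
  have hw : ∀ w, w < tailInv ξ (s (Fin.last d)) →
      ENNReal.ofReal (gev ξ w) ≤ liminf (fun n => Φ n s) atTop := by
    intro w hw
    have hlim : Tendsto (fun n => c n * ENNReal.ofReal (cdf ν (a n * w + b n) ^ n)) atTop
        (𝓝 (ENNReal.ofReal (gev ξ w))) := by
      have h1 : Tendsto c atTop (𝓝 (ENNReal.ofReal 1)) :=
        ENNReal.tendsto_ofReal (tendsto_descFactorial_mul (d + 1))
      have h2 := ENNReal.tendsto_ofReal (hab.2 w)
      rw [ENNReal.ofReal_one] at h1
      simpa using ENNReal.Tendsto.mul h1 (Or.inl one_ne_zero) h2 (Or.inr ENNReal.one_ne_top)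
    rw [← hlim.liminf_eq]
    refine liminf_le_liminf ?_
    filter_upwards [hmemB, hmemG, hmemA, (hnorm (Fin.last d)).eventually_const_lt hw]
      with n h1 h2 h3 h4
    rw [hΦ]
    dsimp only
    rw [indicator_of_mem h1, indicator_of_mem (show z n s ∈ G n ∩ {z | StrictAnti z} from ⟨h2, h3⟩), hg]
    dsimp only
    gcongr
    rw [lt_div_iff₀ (hab.1 n), lt_sub_iff_add_lt, mul_comm] at h4
    rw [ENNReal.ofReal_pow (cdf_nonneg _ _), ofReal_cdf]
    calc ν (Iic (a n * w + b n)) ^ n ≤ ν (Iic (a n * w + b n)) ^ (n - (d + 1)) :=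
          pow_le_pow_right_of_le_one' prob_le_one (Nat.sub_le _ _)
      _ ≤ ν (Iio (z n s (Fin.last d))) ^ (n - (d + 1)) := by
          gcongr
  have hcont : Tendsto (fun w => ENNReal.ofReal (gev ξ w)) (𝓝[<] (tailInv ξ (s (Fin.last d))))
      (𝓝 (ENNReal.ofReal (Real.exp (-s (Fin.last d))))) := by
    rw [← gev_tailInv ξ (hs.2 _)]
    exact ENNReal.tendsto_ofReal ((continuousAt_gev_tailInv ξ).tendsto.mono_left nhdsWithin_le_nhds)
  refine le_of_tendsto hcont ?_
  filter_upwards [self_mem_nhdsWithin] with w hwlt using hw w hwlt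

/-! ### A mean value inequality for the local slope -/

lemma eventually_abs_sub_le_of_gradNorm_le {p : ℕ} {h : EuclideanSpace ℝ (Fin p) → ℝ}
    {θ : EuclideanSpace ℝ (Fin p)} {L M : ℝ} (hL : 0 ≤ L) (hLM : L < M)
    (hθ : gradNorm h θ ≤ ENNReal.ofReal L) : ∀ᶠ y in 𝓝 θ, |h y - h θ| ≤ M * ‖y - θ‖ := by
  unfold gradNorm at hθ
  split_ifs at hθ with hd
  · have h1 : ‖fderiv ℝ h θ‖ ≤ L := by
      rw [ENNReal.ofReal_le_ofReal_iff hL, gradient, LinearIsometryEquiv.norm_map] at hθ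
      exact hθ
    filter_upwards [hd.hasFDerivAt.isLittleO.bound (sub_pos.2 hLM)] with y hy
    have h2 := (fderiv ℝ h θ).le_opNorm (y - θ)
    have h3 : ‖h y - h θ‖ ≤ ‖h y - h θ - fderiv ℝ h θ (y - θ)‖ + ‖fderiv ℝ h θ (y - θ)‖ := by
      simpa using norm_add_le (h y - h θ - fderiv ℝ h θ (y - θ)) (fderiv ℝ h θ (y - θ))
    rw [Real.norm_eq_abs] at h3
    nlinarith [mul_le_mul_of_nonneg_right h1 (norm_nonneg (y - θ))]
  · have h1 := eventually_lt_of_limsup_lt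
      (hθ.trans_lt ((ENNReal.ofReal_lt_ofReal_iff (hL.trans_lt hLM)).2 hLM))
    rw [eventually_nhdsWithin_iff] at h1
    filter_upwards [h1] with y hy
    by_cases hyθ : y = θ
    · simp [hyθ]
    · have h2 := hy hyθ
      have h3 : 0 < ‖y - θ‖ := norm_pos_iff.2 (sub_ne_zero.2 hyθ)
      rw [ENNReal.ofReal_lt_ofReal_iff (hL.trans_lt hLM), div_lt_iff₀ h3] at h2
      exact h2.le

/-- Local slopes bounded near each point of a segment integrate to a global bound by the mean value
inequality for upper right slopes, without differentiability. -/
lemma abs_sub_le_of_eventually_abs_sub_le {E : Type*} [NormedAddCommGroup E] [NormedSpace ℝ E]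
    {h : E → ℝ} {s : Set E} (hs : Convex ℝ s) {L : ℝ}
    (hloc : ∀ θ ∈ s, ∀ M, L < M → ∀ᶠ y in 𝓝 θ, |h y - h θ| ≤ M * ‖y - θ‖) {x y : E} (hx : x ∈ s)
    (hy : y ∈ s) : |h y - h x| ≤ L * ‖y - x‖ := by
  by_cases hxy : y = x
  · simp [hxy]
  have hv : 0 < ‖y - x‖ := norm_pos_iff.2 (sub_ne_zero.2 hxy)
  have key : ∀ M, L < M → |h y - h x| ≤ M * ‖y - x‖ := by
    intro M hM
    -- The slope bound `M'` must be strictly below the slope `M` of the comparison line.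
    obtain ⟨M', hLM', hM'M⟩ := exists_between hM
    set γ : ℝ → E := fun t => x + t • (y - x) with hγ
    have hγc : Continuous γ := by fun_prop
    have hγs : ∀ t ∈ Icc (0 : ℝ) 1, γ t ∈ s := fun t ht => hs.add_smul_sub_mem hx hy ht
    have hγd : ∀ t u, γ u - γ t = (u - t) • (y - x) := fun t u => by
      simp only [hγ]; module
    have hev : ∀ t ∈ Icc (0 : ℝ) 1, ∀ᶠ u in 𝓝 t, |h (γ u) - h (γ t)| ≤ M' * ‖y - x‖ * |u - t| := by
      intro t ht
      filter_upwards [hγc.continuousAt.eventually (hloc _ (hγs t ht) M' hLM')] with u hu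
      rw [hγd, norm_smul, Real.norm_eq_abs] at hu
      linarith
    have hcont : ContinuousOn (fun t => h (γ t) - h x) (Icc 0 1) := by
      intro t ht
      refine ContinuousAt.continuousWithinAt (ContinuousAt.sub ?_ continuousAt_const)
      refine tendsto_iff_norm_sub_tendsto_zero.2 ?_
      have hz : Tendsto (fun u => M' * ‖y - x‖ * |u - t|) (𝓝 t) (𝓝 0) := by
        have : Continuous fun u => M' * ‖y - x‖ * |u - t| := by fun_prop
        simpa using this.tendsto t
      exact squeeze_zero' (Eventually.of_forall fun _ => norm_nonneg _) (hev t ht) hz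
    have := image_norm_le_of_liminf_right_slope_norm_lt_deriv_boundary
      (f := fun t => h (γ t) - h x) (f' := fun _ => M' * ‖y - x‖)
      (B := fun t => M * ‖y - x‖ * t) (B' := fun _ => M * ‖y - x‖) hcont
      (fun t ht r hr => ?_) (by simp [hγ]) (by fun_prop)
      (fun t _ => by simpa using ((hasDerivAt_id t).const_mul (M * ‖y - x‖)).hasDerivWithinAt)
      (fun t _ _ => mul_lt_mul_of_pos_right hM'M hv) (right_mem_Icc.2 zero_le_one)
    · simpa [hγ] using this
    · refine Eventually.frequently ?_
      filter_upwards [(hev t (Ico_subset_Icc_self ht)).filter_mono nhdsWithin_le_nhds,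
        self_mem_nhdsWithin] with u hu hut
      have hpos : 0 < u - t := sub_pos.2 hut
      rw [slope_def_field, div_lt_iff₀ hpos]
      rw [abs_of_pos hpos] at hu
      have h2 : ‖h (γ u) - h x‖ - ‖h (γ t) - h x‖ ≤ |h (γ u) - h (γ t)| := by
        simpa using norm_sub_norm_le (h (γ u) - h x) (h (γ t) - h x)
      simp only [Function.comp_apply]
      nlinarith
  refine le_of_forall_pos_le_add fun e he => ?_
  have := key (L + e / ‖y - x‖) (by linarith [div_pos he hv])
  rwa [add_mul, div_mul_cancel₀ _ hv.ne'] at this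

lemma abs_sub_le_of_gradNorm_le {p : ℕ} {h : EuclideanSpace ℝ (Fin p) → ℝ}
    {c : EuclideanSpace ℝ (Fin p)} {η L : ℝ} (hL : 0 ≤ L)
    (hb : ∀ θ ∈ Metric.ball c η, gradNorm h θ ≤ ENNReal.ofReal L) {θ : EuclideanSpace ℝ (Fin p)}
    (hθ : θ ∈ Metric.ball c η) : |h θ - h c| ≤ L * ‖θ - c‖ :=
  abs_sub_le_of_eventually_abs_sub_le (convex_ball c η)
    (fun θ' hθ' _ hM => eventually_abs_sub_le_of_gradNorm_le hL hM (hb θ' hθ'))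
    (Metric.mem_ball_self (dist_nonneg.trans_lt hθ)) hθ

/-! ### The effect of the estimation error -/

/-- On an event of probability close to one, all changes are at most `|C| * |ρ n| * |η n|`. Since `ρ
= O(a)` and `η n → 0`, this is eventually below `δ * a n`. -/
theorem tendsto_measure_perturbation {Ω 𝒟 : Type*} [MeasurableSpace Ω] {p : ℕ} {μ : Measure Ω}
    [IsProbabilityMeasure μ] {A : EuclideanSpace ℝ (Fin p) → 𝒟 → ℝ} {D : ℕ → Ω → 𝒟}
    {θ₀ : EuclideanSpace ℝ (Fin p)} {θhat : ℕ → Ω → EuclideanSpace ℝ (Fin p)}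
    (hθm : ∀ n, Measurable (θhat n)) {η : ℕ → ℝ} (hη : Tendsto η atTop (𝓝 0))
    (hball : Tendsto (fun n => μ {ω | θhat n ω ∈ Metric.ball θ₀ (η n)}) atTop (𝓝 1))
    {ρ : ℕ → ℝ} (hO : IsBigOInProbability μ (fun n => supGrad A D θ₀ (η n) n) ρ)
    {a : ℕ → ℝ} (ha : ∀ n, 0 < a n) (hρ : ρ =O[atTop] a) {δ : ℝ} (hδ : 0 < δ) :
    Tendsto (fun n : ℕ => μ {ω | ¬ ∀ i : Fin n,
      |A (θhat n ω) (D i ω) - A θ₀ (D i ω)| ≤ δ * a n}) atTop (𝓝 0) := by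
  have hout : Tendsto (fun n => μ {ω | θhat n ω ∈ Metric.ball θ₀ (η n)}ᶜ) atTop (𝓝 0) := by
    have h1 : ∀ n, μ {ω | θhat n ω ∈ Metric.ball θ₀ (η n)}ᶜ =
        1 - μ {ω | θhat n ω ∈ Metric.ball θ₀ (η n)} := fun n =>
      prob_compl_eq_one_sub (hθm n Metric.isOpen_ball.measurableSet)
    simp only [h1]
    have h2 := ENNReal.Tendsto.sub (tendsto_const_nhds (x := (1 : ℝ≥0∞))) hball
      (Or.inl ENNReal.one_ne_top)
    rwa [tsub_self] at h2
  rw [ENNReal.tendsto_nhds_zero] at hout ⊢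
  intro e he
  have he2 : 0 < e / 2 := ENNReal.half_pos he.ne'
  obtain ⟨e', he'0, he'⟩ := ENNReal.lt_iff_exists_nnreal_btwn.1 he2
  obtain ⟨C, hC⟩ := hO e' (by exact_mod_cast he'0)
  obtain ⟨K, hK⟩ := hρ.bound
  have hsmall : ∀ᶠ n in atTop, |C| * K * |η n| ≤ δ := by
    have h1 : Tendsto (fun n => |C| * K * |η n|) atTop (𝓝 0) := by
      simpa using hη.abs.const_mul (|C| * K)
    exact h1.eventually_le_const hδ
  filter_upwards [hC, hK, hsmall, hout (e / 2) he2] with n hCn hKn hsn hon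
  have hsub : {ω | ¬ ∀ i : Fin n, |A (θhat n ω) (D i ω) - A θ₀ (D i ω)| ≤ δ * a n} ⊆
      {ω | ENNReal.ofReal (C * ρ n) < supGrad A D θ₀ (η n) n ω} ∪
        {ω | θhat n ω ∈ Metric.ball θ₀ (η n)}ᶜ := by
    intro ω hω
    by_contra hcon
    simp only [mem_union, mem_ofPred_eq, mem_compl_iff, not_or, not_lt, not_not] at hcon
    refine hω fun i => ?_
    set L := |C| * |ρ n| with hL
    have hL0 : 0 ≤ L := by positivity
    have hsup : supGrad A D θ₀ (η n) n ω ≤ ENNReal.ofReal L :=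
      hcon.1.trans (ENNReal.ofReal_le_ofReal (by rw [hL, ← abs_mul]; exact le_abs_self _))
    have hgrad : ∀ θ ∈ Metric.ball θ₀ (η n),
        gradNorm (fun t => A t (D i ω)) θ ≤ ENNReal.ofReal L := fun θ hθ =>
      le_trans (le_iSup_of_le i (le_iSup₂ (f := fun θ' (_ : θ' ∈ Metric.ball θ₀ (η n)) =>
        gradNorm (fun t => A t (D i ω)) θ') θ hθ)) hsup
    have h1 := abs_sub_le_of_gradNorm_le (h := fun t => A t (D i ω)) hL0 hgrad hcon.2
    have h2 : ‖θhat n ω - θ₀‖ ≤ |η n| := by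
      have := hcon.2
      rw [Metric.mem_ball, dist_eq_norm] at this
      exact this.le.trans (le_abs_self _)
    have h3 : |ρ n| ≤ K * a n := by
      simpa [abs_of_pos (ha n)] using hKn
    calc |A (θhat n ω) (D i ω) - A θ₀ (D i ω)| ≤ L * ‖θhat n ω - θ₀‖ := h1
      _ ≤ (|C| * (K * a n)) * |η n| := by
          have h4 : 0 ≤ K * a n := (abs_nonneg _).trans h3
          rw [hL]
          gcongr
      _ = (|C| * K * |η n|) * a n := by ring
      _ ≤ δ * a n := mul_le_mul_of_nonneg_right hsn (ha n).le
  calc _ ≤ _ := measure_mono hsub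
    _ ≤ _ := measure_union_le _ _
    _ ≤ e / 2 + e / 2 := by
        refine add_le_add (hCn.trans ?_) hon
        rw [ENNReal.ofReal_coe_nnreal]
        exact he'.le
    _ = e := ENNReal.add_halves e

/-! ### Asymptotic law of the self-normalized statistics -/

lemma selfNormalizedTop_eq {n m : ℕ} {x : Fin n → ℝ}
    (hx : topValues (m + 2) x (Fin.last (m + 1)) < topValues (m + 2) x 0) :
    selfNormalizedTop (m + 2) x = completeVec (m + 2) (spacingRatio m (topValues (m + 2) x)) := by
  have hne : orderStat x 0 - orderStat x (m + 1) ≠ 0 := (sub_pos.2 hx).ne'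
  funext j
  induction j using Fin.lastCases with
  | last =>
    rw [completeVec_last]
    simp [selfNormalizedTop]
  | cast j =>
    induction j using Fin.cases with
    | zero =>
      rw [Fin.castSucc_zero, completeVec_zero]
      exact div_self hne
    | succ j =>
      rw [completeVec_castSucc_succ]
      rfl

/-- The vectors with separated extreme coordinates and spacing ratios in `B`. -/
def ratioRegion (m : ℕ) (B : Set (Fin m → ℝ)) : Set (Fin (m + 2) → ℝ) :=
  {x | x (Fin.last (m + 1)) < x 0 ∧ spacingRatio m x ∈ B}

lemma isOpen_ratioRegion {m : ℕ} {B : Set (Fin m → ℝ)} (hB : IsOpen B) :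
    IsOpen (ratioRegion m B) := by
  have ho : IsOpen {x : Fin (m + 2) → ℝ | x (Fin.last (m + 1)) < x 0} :=
    isOpen_lt (continuous_apply _) (continuous_apply _)
  have hc : ContinuousOn (spacingRatio m) {x | x (Fin.last (m + 1)) < x 0} := by
    refine continuousOn_pi.2 fun i => ContinuousOn.div (by fun_prop) (by fun_prop) fun x hx => ?_
    exact (sub_pos.2 hx).ne'
  exact hc.isOpen_inter_preimage ho hB

/-- This is where the unknown norming constants drop out of the statistic. -/
lemma affine_mem_ratioRegion_iff {m : ℕ} {B : Set (Fin m → ℝ)} {a : ℝ} (ha : 0 < a) (b : ℝ)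
    (x : Fin (m + 2) → ℝ) : (fun j => (x j - b) / a) ∈ ratioRegion m B ↔ x ∈ ratioRegion m B := by
  have h1 : spacingRatio m (fun j => (x j - b) / a) = spacingRatio m x := by
    funext i
    simp only [spacingRatio]
    rw [← sub_div, ← sub_div, div_div_div_cancel_right₀ ha.ne', sub_sub_sub_cancel_right,
      sub_sub_sub_cancel_right]
  simp only [ratioRegion, mem_ofPred_eq, h1, div_lt_div_iff_of_pos_right ha, sub_lt_sub_iff_right]

/-- Open regions have asymptotically at least the limiting probability, and small perturbations of
the sample do not matter. -/
theorem le_liminf_ratioRegion {Ω : Type*} [MeasurableSpace Ω] {μ : Measure Ω} {m : ℕ}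
    {ν : Measure ℝ} [IsProbabilityMeasure ν] {ξ : ℝ} (hξ : 0 ≤ ξ) {a b : ℕ → ℝ}
    (hab : IsNorming ν ξ a b) {X Y : ∀ n, Ω → Fin n → ℝ} (hXm : ∀ n, Measurable (X n))
    (hX : ∀ n, μ.map (X n) = Measure.pi fun _ => ν)
    (hXY : ∀ δ : ℝ, 0 < δ → Tendsto (fun n => μ {ω | ¬ ∀ i, |Y n ω i - X n ω i| ≤ δ * a n})
      atTop (𝓝 0)) {B : Set (Fin m → ℝ)} (hB : IsOpen B) :
    ∫⁻ w in reverseSimplex m 1, B.indicator 1 w * limitDensity (completeVec (m + 2) w) ξ ≤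
      liminf (fun n => μ {ω | topValues (m + 2) (Y n ω) ∈ ratioRegion m B}) atTop := by
  set O := ratioRegion m B with hO
  have hOo : IsOpen O := isOpen_ratioRegion hB
  -- Points farther than `1 / (l + 1)` from the complement of `O`: a normalized perturbation of at
  -- most that size cannot leave `O`. As `l → ∞` these open sets exhaust `O`.
  set U : ℕ → Set (Fin (m + 2) → ℝ) := fun l =>
    {x | ENNReal.ofReal (1 / ((l : ℝ) + 1)) < Metric.infEDist x Oᶜ} with hU
  have hUo : ∀ l, IsOpen (U l) := fun l => isOpen_lt continuous_const Metric.continuous_infEDist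
  have hdelta : ∀ l : ℕ, (0 : ℝ) < 1 / ((l : ℝ) + 1) := fun l => by positivity
  have hstep : ∀ l, ∫⁻ s in openChamber (m + 2), (U l).indicator 1 (fun i => tailInv ξ (s i)) *
        ENNReal.ofReal (Real.exp (-s (Fin.last (m + 1)))) ≤
      liminf (fun n => μ {ω | topValues (m + 2) (Y n ω) ∈ O}) atTop := by
    intro l
    refine (le_liminf_topValues ν hξ hab (hUo l)).trans ?_
    refine le_trans (liminf_le_liminf ?_)
      -- The event of a large perturbation has vanishing probability and does not affect the liminf.
      (le_of_eq (ENNReal.liminf_add_of_right_tendsto_zero (hXY _ (hdelta l)) _))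
    filter_upwards [eventually_ge_atTop (m + 2)] with n hn
    have hmeas : MeasurableSet {x : Fin n → ℝ |
        (fun j => (topValues (m + 2) x j - b n) / a n) ∈ U l} := by
      have h1 : Measurable fun (x : Fin n → ℝ) j => (topValues (m + 2) x j - b n) / a n :=
        measurable_pi_iff.2 fun j => ((measurable_orderStat n j).sub_const _).div_const _
      exact h1 (hUo l).measurableSet
    change _ ≤ μ _ + μ _
    rw [← hX n, Measure.map_apply (hXm n) hmeas]
    refine le_trans (measure_mono fun ω hω => ?_) (measure_union_le _ _)
    by_contra hcon
    simp only [mem_union, mem_ofPred_eq, not_or, not_not] at hcon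
    refine hcon.1 ?_
    rw [hO, ← affine_mem_ratioRegion_iff (hab.1 n) (b n)]
    by_contra hnot
    have hlt : ENNReal.ofReal (1 / ((l : ℝ) + 1)) <
        Metric.infEDist (fun j => (topValues (m + 2) (X n ω) j - b n) / a n) Oᶜ := hω
    refine absurd (hlt.trans_le (Metric.infEDist_le_edist_of_mem hnot)) (not_lt.2 ?_)
    rw [edist_dist]
    refine ENNReal.ofReal_le_ofReal ((dist_pi_le_iff (hdelta l).le).2 fun j => ?_)
    have h2 := abs_orderStat_sub_le (j := j) (j.2.trans_le hn) hcon.2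
    rw [dist_comm, Real.dist_eq, ← sub_div, sub_sub_sub_cancel_right, abs_div,
      abs_of_pos (hab.1 n), div_le_iff₀ (hab.1 n)]
    exact h2
  have htm : Measurable fun (s : Fin (m + 2) → ℝ) i => tailInv ξ (s i) :=
    measurable_pi_iff.2 fun i => (measurable_tailInv ξ).comp (measurable_pi_apply i)
  rw [← lintegral_openChamber_eq hξ (measurable_one.indicator hB.measurableSet)]
  calc _ ≤ ∫⁻ s in openChamber (m + 2), liminf (fun l => (U l).indicator 1
          (fun i => tailInv ξ (s i)) * ENNReal.ofReal (Real.exp (-s (Fin.last (m + 1))))) atTop := by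
        refine setLIntegral_mono' (measurableSet_openChamber _) fun s hs => ?_
        by_cases hsB : spacingRatio m (fun i => tailInv ξ (s i)) ∈ B
        swap
        · rw [indicator_of_notMem hsB, zero_mul]
          exact zero_le
        have hmem : (fun i => tailInv ξ (s i)) ∈ O :=
          ⟨tailInv_lt_tailInv hξ (hs.2 0) (hs.1 (Fin.last_pos)), hsB⟩
        have hpos : 0 < Metric.infEDist (fun i => tailInv ξ (s i)) Oᶜ := by
          rw [pos_iff_ne_zero, Ne, ← Metric.mem_closure_iff_infEDist_zero,
            hOo.isClosed_compl.closure_eq]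
          exact fun h => h hmem
        have hz : Tendsto (fun l : ℕ => ENNReal.ofReal (1 / ((l : ℝ) + 1))) atTop (𝓝 0) := by
          have := ENNReal.tendsto_ofReal (tendsto_one_div_add_atTop_nhds_zero_nat (𝕜 := ℝ))
          rwa [ENNReal.ofReal_zero] at this
        refine le_liminf_of_le (by isBoundedDefault) ?_
        filter_upwards [hz.eventually_lt_const hpos] with l hl
        rw [indicator_of_mem hsB, indicator_of_mem (show _ ∈ U l from hl)]
        exact le_rfl
    _ ≤ liminf (fun l => ∫⁻ s in openChamber (m + 2), (U l).indicator 1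
          (fun i => tailInv ξ (s i)) * ENNReal.ofReal (Real.exp (-s (Fin.last (m + 1))))) atTop :=
        lintegral_liminf_le fun l =>
          ((measurable_one.indicator (hUo l).measurableSet).comp htm).mul (by fun_prop)
    _ ≤ liminf (fun _ : ℕ => liminf (fun n => μ {ω | topValues (m + 2) (Y n ω) ∈ O}) atTop)
          atTop := liminf_le_liminf (Eventually.of_forall hstep)
    _ = _ := liminf_const _

/-- Convergence of the rejection probability from two complementary open regions. -/
lemma tendsto_lintegral_test {Ω : Type*} [MeasurableSpace Ω] {μ : Measure Ω}
    [IsProbabilityMeasure μ] {m : ℕ} {ε : ℝ} {W Λ : Measure ℝ} {Y : ∀ n, Ω → Fin n → ℝ}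
    (hYm : ∀ n, Measurable (Y n)) {R A : Set (Fin m → ℝ)} (hRo : IsOpen R) (hAo : IsOpen A)
    (hR : ∀ w ∈ R, test ε W Λ (completeVec (m + 2) w) = 1)
    (hA : ∀ w ∈ A, test ε W Λ (completeVec (m + 2) w) = 0) {L : Set (Fin m → ℝ) → ℝ≥0∞}
    (hL : ∀ B, IsOpen B →
      L B ≤ liminf (fun n => μ {ω | topValues (m + 2) (Y n ω) ∈ ratioRegion m B}) atTop)
    (hsum : L R + L A = 1) :
    Tendsto (fun n => ∫⁻ ω, test ε W Λ (selfNormalizedTop (m + 2) (Y n ω)) ∂μ) atTop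
      (𝓝 (L R)) := by
  have hm : ∀ B, IsOpen B → ∀ n, MeasurableSet {ω | topValues (m + 2) (Y n ω) ∈ ratioRegion m B} :=
    fun B hB n => ((measurable_topValues n (m + 2)).comp (hYm n)) (isOpen_ratioRegion hB).measurableSet
  have hle1 : ∀ v : Fin (m + 2) → ℝ, test ε W Λ v ≤ 1 := fun v => by
    unfold test; split_ifs <;> simp
  have hval : ∀ (B : Set (Fin m → ℝ)) n ω, topValues (m + 2) (Y n ω) ∈ ratioRegion m B →
      ∃ w ∈ B, selfNormalizedTop (m + 2) (Y n ω) = completeVec (m + 2) w := fun B n ω h =>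
    ⟨_, h.2, selfNormalizedTop_eq h.1⟩
  refine tendsto_of_le_liminf_of_limsup_le ?_ ?_
  · refine (hL R hRo).trans (liminf_le_liminf (Eventually.of_forall fun n => ?_))
    rw [← lintegral_indicator_one (hm R hRo n)]
    refine lintegral_mono fun ω => ?_
    by_cases hω : topValues (m + 2) (Y n ω) ∈ ratioRegion m R
    · obtain ⟨w, hw, heq⟩ := hval R n ω hω
      rw [indicator_of_mem (show ω ∈ {ω' | topValues (m + 2) (Y n ω') ∈ ratioRegion m R} from hω), heq, hR w hw]
      exact le_rfl
    · rw [indicator_of_notMem (show ω ∉ {ω' | topValues (m + 2) (Y n ω') ∈ ratioRegion m R} from hω)]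
      exact zero_le
  -- The upper bound is the lower bound for the acceptance region, read through the complement.
  · have hup : ∀ n, ∫⁻ ω, test ε W Λ (selfNormalizedTop (m + 2) (Y n ω)) ∂μ ≤
        1 - μ {ω | topValues (m + 2) (Y n ω) ∈ ratioRegion m A} := by
      intro n
      refine ENNReal.le_sub_of_add_le_right (measure_ne_top _ _) ?_
      rw [← lintegral_indicator_one (hm A hAo n),
        ← lintegral_add_right _ (measurable_one.indicator (hm A hAo n))]
      refine (lintegral_mono fun ω => ?_).trans (le_of_eq (show ∫⁻ _ω, 1 ∂μ = 1 by simp))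
      by_cases hω : topValues (m + 2) (Y n ω) ∈ ratioRegion m A
      · obtain ⟨w, hw, heq⟩ := hval A n ω hω
        rw [indicator_of_mem (show ω ∈ {ω' | topValues (m + 2) (Y n ω') ∈ ratioRegion m A} from hω), heq, hA w hw, zero_add]
        exact le_rfl
      · rw [indicator_of_notMem (show ω ∉ {ω' | topValues (m + 2) (Y n ω') ∈ ratioRegion m A} from hω), add_zero]
        exact hle1 _
    refine (limsup_le_limsup (Eventually.of_forall hup)).trans ?_
    rw [ENNReal.limsup_const_sub _ _ ENNReal.one_ne_top]
    have hLA : L A ≠ ∞ := fun h => by simp [h] at hsum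
    calc 1 - liminf (fun n => μ {ω | topValues (m + 2) (Y n ω) ∈ ratioRegion m A}) atTop
        ≤ 1 - L A := tsub_le_tsub_left (hL A hAo) 1
      _ = L R := ENNReal.sub_eq_of_eq_add hLA hsum.symm

/-- The regions of rejection and acceptance, up to null sets. -/
lemma exists_open_regions (m : ℕ) {ε : ℝ} (hε₀ : 0 < ε) (hε₁ : ε < 1) (W Λ : Measure ℝ)
    [IsFiniteMeasure W] [IsFiniteMeasure Λ] {ξ : ℝ} (hξ : 0 ≤ ξ) :
    ∃ R A : Set (Fin m → ℝ), IsOpen R ∧ IsOpen A ∧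
      (∀ w ∈ R, test ε W Λ (completeVec (m + 2) w) = 1) ∧
      (∀ w ∈ A, test ε W Λ (completeVec (m + 2) w) = 0) ∧
      ∫⁻ w in reverseSimplex m 1, R.indicator 1 w * limitDensity (completeVec (m + 2) w) ξ =
        limitExpectation (m + 2) ξ (test ε W Λ) ∧
      (∫⁻ w in reverseSimplex m 1, R.indicator 1 w * limitDensity (completeVec (m + 2) w) ξ) +
        (∫⁻ w in reverseSimplex m 1, A.indicator 1 w * limitDensity (completeVec (m + 2) w) ξ) =
        1 := by
  classical
  set N := mixtureDensity m (W.restrict (Ioc (1 - ε) 2)) with hN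
  set M := mixtureDensity m (Λ.restrict (Icc 0 (1 - ε))) with hM
  have hPW := ae_restrict_Ioc_mem (W := W) hε₁
  have hPΛ := ae_restrict_Icc_mem (Λ := Λ) hε₀
  have htest : ∀ w, test ε W Λ (completeVec (m + 2) w) = if M w < N w then 1 else 0 :=
    test_completeVec m ε W Λ
  have hDm : Measurable fun w : Fin m → ℝ => limitDensity (completeVec (m + 2) w) ξ :=
    (measurable_limitDensity_completeVec m).comp (f := fun w : Fin m → ℝ => (w, ξ)) (by fun_prop)
  have hpo : IsOpen {w : Fin m → ℝ | ∀ i, 0 < w i} := by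
    rw [ofPred_forall]
    exact isOpen_iInter_of_finite fun i => isOpen_lt continuous_const (continuous_apply i)
  have hNc : ContinuousOn N {w | ∀ i, 0 < w i} := fun w hw =>
    (continuousAt_mixtureDensity hPW hw).continuousWithinAt
  have hMc : ContinuousOn M {w | ∀ i, 0 < w i} := fun w hw =>
    (continuousAt_mixtureDensity hPΛ hw).continuousWithinAt
  have htot := lintegral_reverseSimplex_limitDensity m hξ
  -- Either the ratio is identically one on the orthant, where the strict inequality in the test
  -- accepts, or the boundary of the rejection region is null.
  rcases mixtureDensity_eq_or_volume_eq_zero m hPW hPΛ with heq | hnull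
  · have hno : ∀ w : Fin m → ℝ, (∀ i, 0 < w i) → test ε W Λ (completeVec (m + 2) w) = 0 :=
      fun w hw => by rw [htest, if_neg (not_lt.2 (heq w hw).le)]
    refine ⟨∅, {w | ∀ i, 0 < w i}, isOpen_empty, hpo, fun w hw => absurd hw (notMem_empty w), hno,
      ?_, ?_⟩
    · rw [limitExpectation_eq]
      refine setLIntegral_congr_fun (measurableSet_reverseSimplex m 1) fun w hw => ?_
      simp only [hno w fun i => (hw.2 i).1, indicator_empty]
    · simp only [indicator_empty, zero_mul, lintegral_zero, zero_add]
      rw [← htot]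
      refine setLIntegral_congr_fun (measurableSet_reverseSimplex m 1) fun w hw => ?_
      rw [indicator_of_mem (show w ∈ {w : Fin m → ℝ | ∀ i, 0 < w i} from fun i => (hw.2 i).1),
        Pi.one_apply, one_mul]
  -- Intersecting with the positive orthant is needed because continuity of the mixtures is known
  -- only there.
  · have hRo : IsOpen ({w : Fin m → ℝ | ∀ i, 0 < w i} ∩ {w | M w < N w}) := by
      have := (hMc.prodMk hNc).isOpen_inter_preimage hpo
        (isOpen_lt continuous_fst continuous_snd : IsOpen {p : ℝ≥0∞ × ℝ≥0∞ | p.1 < p.2})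
      exact this
    have hAo : IsOpen ({w : Fin m → ℝ | ∀ i, 0 < w i} ∩ {w | N w < M w}) := by
      have := (hNc.prodMk hMc).isOpen_inter_preimage hpo
        (isOpen_lt continuous_fst continuous_snd : IsOpen {p : ℝ≥0∞ × ℝ≥0∞ | p.1 < p.2})
      exact this
    refine ⟨_, _, hRo, hAo, fun w hw => by rw [htest, if_pos (show M w < N w from hw.2)],
      fun w hw => by rw [htest, if_neg (not_lt.2 (le_of_lt (show N w < M w from hw.2)))], ?_, ?_⟩
    · rw [limitExpectation_eq]
      refine setLIntegral_congr_fun (measurableSet_reverseSimplex m 1) fun w hw => ?_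
      have hw0 : ∀ i, 0 < w i := fun i => (hw.2 i).1
      simp only [htest, indicator, mem_inter_iff, mem_ofPred_eq, hw0, implies_true, true_and,
        Pi.one_apply]
    · have hRm : Measurable fun w => ({w : Fin m → ℝ | ∀ i, 0 < w i} ∩
          {w | M w < N w}).indicator 1 w * limitDensity (completeVec (m + 2) w) ξ :=
        (measurable_one.indicator hRo.measurableSet).mul hDm
      rw [← lintegral_add_left hRm, ← htot]
      refine lintegral_congr_ae ?_
      filter_upwards [ae_restrict_mem (measurableSet_reverseSimplex m 1),
        ae_restrict_of_ae (measure_eq_zero_iff_ae_notMem.1 hnull)] with w hw hne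
      have hw0 : ∀ i, 0 < w i := fun i => (hw.2 i).1
      have hne' : N w ≠ M w := fun h => hne ⟨hw0, h⟩
      rcases lt_or_gt_of_ne hne' with h | h
      · rw [indicator_of_notMem fun hm => absurd hm.2 (not_lt.2 h.le),
          indicator_of_mem (show w ∈ {w : Fin m → ℝ | ∀ i, 0 < w i} ∩ {w | N w < M w} from ⟨hw0, h⟩)]
        simp
      · rw [indicator_of_mem (show w ∈ {w : Fin m → ℝ | ∀ i, 0 < w i} ∩ {w | M w < N w} from ⟨hw0, h⟩),
          indicator_of_notMem fun hm => absurd hm.2 (not_lt.2 (le_of_lt h))]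
        simp

/-! ### From the statistical model to the limit of the rejection probability -/

section Model

variable {Ω 𝒟 : Type*} [MeasurableSpace Ω] [MeasurableSpace 𝒟] {μ : Measure Ω}
  [IsProbabilityMeasure μ]

theorem map_comp_eq_pi {D : ℕ → Ω → 𝒟} (hD : ∀ i, Measurable (D i)) (hind : iIndepFun D μ)
    (hid : ∀ i, IdentDistrib (D i) (D 0) μ μ) {h : 𝒟 → ℝ} (hh : Measurable h) (n : ℕ) :
    μ.map (fun ω (i : Fin n) => h (D i ω)) = Measure.pi fun _ => μ.map fun ω => h (D 0 ω) := by
  have h1 : iIndepFun (fun (i : Fin n) ω => h (D i ω)) μ :=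
    (hind.precomp Fin.val_injective).comp (fun _ => h) fun _ => hh
  refine ((iIndepFun_iff_map_fun_eq_pi_map fun i : Fin n =>
    (hh.comp (hD i)).aemeasurable).1 h1).trans ?_
  congr 1
  funext i
  exact ((hid i).comp hh).map_eq

theorem measurable_scorePower {p q : ℕ}
    {g : EuclideanSpace ℝ (Fin p) → 𝒟 → EuclideanSpace ℝ (Fin q)}
    (hg : Measurable (Function.uncurry g)) (r : ℝ) :
    Measurable (Function.uncurry (scorePower g r)) :=
  hg.norm.pow_const r

theorem tendsto_rejectionProb {m : ℕ} {ε : ℝ} (hε₀ : 0 < ε) (hε₁ : ε < 1) (W Λ : Measure ℝ)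
    [IsFiniteMeasure W] [IsFiniteMeasure Λ] {p : ℕ} {D : ℕ → Ω → 𝒟}
    {A : EuclideanSpace ℝ (Fin p) → 𝒟 → ℝ} (hA : Measurable (Function.uncurry A))
    (hD : ∀ i, Measurable (D i)) {θ₀ : EuclideanSpace ℝ (Fin p)}
    {θhat : ℕ → Ω → EuclideanSpace ℝ (Fin p)} (hθ : ∀ n, Measurable (θhat n)) {ξ : ℝ}
    (h : RegularityConditions μ D A θ₀ θhat ξ) :
    Tendsto (rejectionProb (m + 2) ε W Λ μ D A θhat) atTop
      (𝓝 (limitExpectation (m + 2) ξ (test ε W Λ))) := by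
  have hAm : Measurable (A θ₀) := hA.comp (measurable_const.prodMk measurable_id)
  have hνp : IsProbabilityMeasure (μ.map fun ω => A θ₀ (D 0 ω)) :=
    Measure.isProbabilityMeasure_map (hAm.comp (hD 0)).aemeasurable
  obtain ⟨η, hη, hball, hpos, hzero⟩ := h.gradientBound
  -- Both cases of the tail index supply a rate of order at most `a n`, which is all that the
  -- perturbation argument requires.
  obtain ⟨ρ, hO, a, b, hab, hρ⟩ : ∃ ρ, GradientCondition μ A D θ₀ η
      (μ.map fun ω => A θ₀ (D 0 ω)) ξ ρ := by
    rcases h.nonneg.lt_or_eq with h0 | h0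
    · exact ⟨_, hpos h0⟩
    · obtain ⟨f, -, -, -, hf⟩ := hzero h0.symm
      exact ⟨_, hf⟩
  obtain ⟨R, B, hRo, hBo, hR, hB, hlim, hsum⟩ := exists_open_regions m hε₀ hε₁ W Λ h.nonneg
  have hY : ∀ n, Measurable fun ω (i : Fin n) => A (θhat n ω) (D i ω) := fun n =>
    measurable_pi_lambda _ fun i => hA.comp ((hθ n).prodMk (hD i))
  have key := tendsto_lintegral_test (μ := μ) (ε := ε) (W := W) (Λ := Λ)
    (Y := fun n ω (i : Fin n) => A (θhat n ω) (D i ω)) hY hRo hBo hR hB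
    (L := fun B => ∫⁻ w in reverseSimplex m 1,
      B.indicator 1 w * limitDensity (completeVec (m + 2) w) ξ)
    (fun B hB => le_liminf_ratioRegion h.nonneg hab
      (fun n => measurable_pi_lambda _ fun i => hAm.comp (hD i))
      (fun n => map_comp_eq_pi hD h.indep h.ident hAm n)
      (fun δ hδ => tendsto_measure_perturbation hθ hη hball hO hab.1 hρ hδ) hB) hsum
  rw [← hlim]
  exact key

theorem limsup_rejectionProb_le {Ω 𝒟 : Type*} [MeasurableSpace Ω] {μ : Measure Ω}
    {k p : ℕ} {ε α ξ : ℝ} {W Λ : Measure ℝ} {D : ℕ → Ω → 𝒟}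
    {A : EuclideanSpace ℝ (Fin p) → 𝒟 → ℝ} {θhat : ℕ → Ω → EuclideanSpace ℝ (Fin p)}
    (hξ : ξ ∈ Icc 0 (1 - ε)) (hlevel : HasLimitLevel k ε W Λ α)
    (hlim : Tendsto (rejectionProb k ε W Λ μ D A θhat) atTop
      (𝓝 (limitExpectation k ξ (test ε W Λ)))) :
    limsup (rejectionProb k ε W Λ μ D A θhat) atTop ≤ ENNReal.ofReal α := by
  rw [hlim.limsup_eq]
  exact (le_iSup₂ (f := fun ξ (_ : ξ ∈ Icc 0 (1 - ε)) => limitExpectation k ξ (test ε W Λ))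
    ξ hξ).trans hlevel

end Model

end FiniteMomentTest

end

open FiniteMomentTest in
theorem theorem1 (k : ℕ) (hk : 3 ≤ k) (ε : ℝ) (hε₀ : 0 < ε) (hε₁ : ε < 1)
    (α : ℝ) (hα : 0 < α) (W : Measure ℝ) [IsFiniteMeasure W] :
    (∀ (Λ₀ : Measure ℝ) [IsFiniteMeasure Λ₀], Λ₀ (Icc 0 (1 - ε)) ≠ 0 →
      ∃ c₀ : ℝ≥0, ∀ c : ℝ≥0, c₀ ≤ c → HasLimitLevel k ε W (c • Λ₀) α) ∧
    (∀ (Λ : Measure ℝ) [IsFiniteMeasure Λ]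
      (Ω : Type*) [MeasurableSpace Ω] (μ : Measure Ω) [IsProbabilityMeasure μ]
      (𝒟 : Type*) [MeasurableSpace 𝒟] (D : ℕ → Ω → 𝒟)
      (p q : ℕ) (g : EuclideanSpace ℝ (Fin p) → 𝒟 → EuclideanSpace ℝ (Fin q))
      (r : ℝ) (θ₀ : EuclideanSpace ℝ (Fin p)) (θhat : ℕ → Ω → EuclideanSpace ℝ (Fin p)) (ξ : ℝ),
      Measurable (Function.uncurry g) → (∀ i, Measurable (D i)) → (∀ n, Measurable (θhat n)) →
      0 < r → ξ ∈ Icc 0 (1 - ε) → RegularityConditions μ D (scorePower g r) θ₀ θhat ξ →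
      Tendsto (rejectionProb k ε W Λ μ D (scorePower g r) θhat) atTop
        (𝓝 (limitExpectation k ξ (test ε W Λ))) ∧
      (HasLimitLevel k ε W Λ α →
        limsup (rejectionProb k ε W Λ μ D (scorePower g r) θhat) atTop ≤ ENNReal.ofReal α)) := by
  -- The first and last coordinates are fixed at `1` and `0`, leaving `m = k - 2` free ones.
  obtain ⟨m, rfl⟩ : ∃ m, k = m + 2 := ⟨k - 2, by omega⟩
  refine ⟨fun Λ₀ _ hΛ₀ => exists_hasLimitLevel m hε₀ hε₁ hα W Λ₀ hΛ₀, ?_⟩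
  intro Λ _ Ω _ μ _ 𝒟 _ D p q g r θ₀ θhat ξ hg hD hθ _ hξ h
  have hlim := tendsto_rejectionProb (m := m) hε₀ hε₁ W Λ (measurable_scorePower hg r) hD hθ h
  exact ⟨hlim, fun hlevel => limsup_rejectionProb_le hξ hlevel hlim⟩
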